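/- Let $\mathcal E$ be the real vector space of smooth functions $g:\mathbb R\to\mathbb R$ such that $\partial_x^n g$ is integrable on $\mathbb R$ for every $n\ge 0$ (so $g$ and all its derivatives vanish at $\pm\infty$), with the topology given by the seminorms $\int|\partial_x^n g|\,dx$. Equip $\mathcal E$ with the constant symplectic form $$\omega(u,v)=\frac12\int_{-\infty}^{\infty}\Bigl(\int_{-\infty}^x v(x)u(y)-u(x)v(y)\,dy\Bigr)dx .$$ The Hamiltonian vector field $X^K$ of a functional $K:\mathcal E\to\mathbb R$ is defined by $X^K(g)\in\mathcal E$ and $\omega(X^K(g),v)=\frac{d}{ds}\big|_{s=0}K(g+sv)$ for all $g,v\in\mathcal E$, and the Poisson bracket is $\{K,L\}=\omega(X^K,X^L)$. For a polynomial $f$ in $g,g_x,g_{xx},\dots$ put $$\frac{\delta f}{\delta g}=\partial_g f-\partial_x(\partial_{g_x}f)+\partial_x^2(\partial_{g_{xx}}f)-\dots .$$ Write $\mathscr D=\partial_x$ and $(\mathscr D^{-1}h)(x)=\int_{-\infty}^x h(y)\,dy$. For $a,b\in\mathbb R$ and $g\in\mathcal E$ define recursively $$X_1(g)=g_x,\qquad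 X_j(g)=\bigl(a g+a\mathscr D g\mathscr D^{-1}+b\mathscr D^2\bigr)X_{j-1}(g)\quad (j\ge 2).$$ **Theorem.** For all $a,b\in\mathbb R$, every $X_j$ $(j\ge1)$ maps $\mathcal E$ to $\mathcal E$, and there are polynomials $f_j$ $(j\ge1)$ in $g,g_x,g_{xx},\dots$ with real coefficients and without constant term such that $f_1=\frac12g^2$ and $\frac{\delta f_j}{\delta g}=\mathscr D^{-1}X_j(g)$ for all $j\ge1$ and $g\in\mathcal E$. For every such sequence $(f_j)$ and all $g\in\mathcal E$ one has $$X_j(g)=\bigl(a g\mathscr D+a\mathscr D g+b\mathscr D^3\bigr)\frac{\delta f_{j-1}}{\delta g}\quad(j\ge2),\qquad X_j(g)=\partial_x\Bigl(\frac{\delta f_j}{\delta g}\Bigr)\quad(j\ge1),$$ and, with $F_j(g)=\int_{-\infty}^\infty f_j(g,g_x,g_{xx},\dots)\,dx$, the following hold. 1. For $a=2$, $b=-1$, $j=2$ one has $X_2(g)=6gg_x-g_{xxx}$ for $g\in\mathcal E$, and a function $u(x,t)$ with $u(\cdot,t)\in\mathcal E$ for all $t\in\mathbb R$ solves $u_t=X_2(u)$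 if and only if it solves the KdV equation $u_t-6uu_x+u_{xxx}=0$. 2. For every $j\ge1$ the integral $F_j(g)$ converges absolutely for all $g\in\mathcal E$, and the equation $u_t=X_j(u)$ is Hamiltonian with Hamiltonian function $F_j$: $X^{F_j}$ exists, is unique, and equals $X_j$ on $\mathcal E$. 3. $\{F_j,F_k\}=0$ on $\mathcal E$ for all $j,k\ge1$. 4. For $a=2$, $b=-1$ the Hamiltonian $H(g)=\int_{-\infty}^\infty g^3+\frac12(g_x)^2\,dx$ of the KdV equation satisfies $H=F_2$ on $\mathcal E$, and $\{H,F_k\}=0$ for all $k\ge1$. Thus all $F_k$ are integrals of the KdV equation: if $t\mapsto u(\cdot,t)$ is a differentiable curve in $\mathcal E$ solving $u_t-6uu_x+u_{xxx}=0$ for all $t\in\mathbb R$, then $F_k(u(\cdot,t))$ does not depend on $t$. -/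

import Mathlib

open MeasureTheory Filter Topology
open scoped ContDiff

noncomputable section

/-- The phase space: smooth functions `g : ℝ → ℝ` all of whose derivatives (`g` included) are
integrable. Then `g` and all its derivatives tend to `0` at `±∞`, so that integrations by parts have
no boundary terms. All Schwartz functions, in particular all compactly supported smooth functions,
belong to it. It is a vector space, hence its own tangent space at every point. -/
def phaseSpace : Submodule ℝ (ℝ → ℝ) where
  carrier := {g | ContDiff ℝ ∞ g ∧ ∀ n : ℕ, Integrable (iteratedDeriv n g)}
  zero_mem' := by
    refine ⟨contDiff_const, fun n => ?_⟩
    have h : iteratedDeriv n (0 : ℝ → ℝ) = 0 := by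
      funext x
      simp
    rw [h]
    exact integrable_zero _ _ _
  add_mem' := by
    rintro g h ⟨hg, hg'⟩ ⟨hh, hh'⟩
    refine ⟨hg.add hh, fun n => ?_⟩
    have e : iteratedDeriv n (g + h) = iteratedDeriv n g + iteratedDeriv n h := by
      funext x
      exact iteratedDeriv_add ((hg.of_le (by exact_mod_cast le_top)).contDiffAt)
        ((hh.of_le (by exact_mod_cast le_top)).contDiffAt)
    rw [e]
    exact (hg' n).add (hh' n)
  smul_mem' := by
    rintro c g ⟨hg, hg'⟩
    refine ⟨contDiff_const.smul hg, fun n => ?_⟩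
    have e : iteratedDeriv n (c • g) = c • iteratedDeriv n g := by
      funext x
      exact iteratedDeriv_const_smul_field c g
    rw [e]
    exact (hg' n).smul c

/-- The inverse `𝒟⁻¹` of `𝒟 = ∂ₓ`: integration from `-∞` to `x`. -/
def antideriv (h : ℝ → ℝ) (x : ℝ) : ℝ := ∫ y in Set.Iic x, h y

/-- The symplectic form
`ω(u, v) = ½ ∫_{-∞}^{∞} (∫_{-∞}^{x} v(x) u(y) - u(x) v(y) dy) dx`
(the same at every foot point). -/
def symplecticForm (u v : ℝ → ℝ) : ℝ :=
  (1 / 2) * ∫ x, ∫ y in Set.Iic x, (v x * u y - u x * v y)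

/-- `w` is the value at `g` of the Hamiltonian vector field of the functional `K`: `w` lies in the
phase space and `ω(w, v) = dK|_g(v) = d/ds|_{s=0} K(g + s v)` for every tangent vector `v`. -/
def IsHamiltonianVectorAt (K : (ℝ → ℝ) → ℝ) (g w : ℝ → ℝ) : Prop :=
  w ∈ phaseSpace ∧
    ∀ v ∈ phaseSpace, HasDerivAt (fun s : ℝ => K (g + s • v)) (symplecticForm w v) 0

open Classical in
/-- The Hamiltonian vector field `X^K` of a functional `K`
(by convention `0` at points where there is none). -/
def hamiltonianVectorField (K : (ℝ → ℝ) → ℝ) (g : ℝ → ℝ) : ℝ → ℝ :=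
  if h : ∃ w, IsHamiltonianVectorAt K g w then h.choose else 0

/-- The Poisson bracket `{K, L} = ω(X^K, X^L)`, as a function on the phase space. -/
def poissonBracket (K L : (ℝ → ℝ) → ℝ) (g : ℝ → ℝ) : ℝ :=
  symplecticForm (hamiltonianVectorField K g) (hamiltonianVectorField L g)

/-- Differential polynomials: the variable `MvPolynomial.X n` stands for the `n`-th derivative
`∂ₓⁿ g`. `evalJet f g` is the function `x ↦ f(g(x), g_x(x), g_xx(x), …)`. -/
def evalJet (f : MvPolynomial ℕ ℝ) (g : ℝ → ℝ) (x : ℝ) : ℝ :=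
  MvPolynomial.eval (fun n => iteratedDeriv n g x) f

/-- The variational derivative
`δf/δg = ∂f/∂g - ∂ₓ (∂f/∂g_x) + ∂ₓ² (∂f/∂g_xx) - …`, as a function of `x`. -/
def variationalDeriv (f : MvPolynomial ℕ ℝ) (g : ℝ → ℝ) (x : ℝ) : ℝ :=
  ∑ n ∈ f.vars, (-1) ^ n * iteratedDeriv n (evalJet (MvPolynomial.pderiv n f) g) x

/-- The functional `F(g) = ∫ f(g(x), g_x(x), g_xx(x), …) dx` with density `f`. -/
def functional (f : MvPolynomial ℕ ℝ) (g : ℝ → ℝ) : ℝ := ∫ x, evalJet f g x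

/-- The vector fields `X_j`, `j ≥ 1`, of the KdV hierarchy with parameters `a`, `b`:
`X_1(g) = g_x` and `X_{j+1}(g) = (a g + a 𝒟 g 𝒟⁻¹ + b 𝒟²) X_j(g)`.
(The index `0` is not used.) -/
def kdvField (a b : ℝ) : ℕ → (ℝ → ℝ) → (ℝ → ℝ)
  | 0, _ => 0
  | 1, g => deriv g
  | j + 2, g => fun x =>
      a * g x * kdvField a b (j + 1) g x
        + a * deriv (fun y => g y * antideriv (kdvField a b (j + 1) g) y) x
        + b * iteratedDeriv 2 (kdvField a b (j + 1) g) x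

/-- `f_1, f_2, …` are Hamiltonian densities of the hierarchy: `f_1 = ½ g²`, and each `f_j` is a
differential polynomial without constant term with `δf_j/δg = 𝒟⁻¹ X_j(g)`. -/
structure IsKdVDensities (a b : ℝ) (f : ℕ → MvPolynomial ℕ ℝ) : Prop where
  one : f 1 = MvPolynomial.C (1 / 2) * MvPolynomial.X 0 ^ 2
  constantCoeff : ∀ j, 1 ≤ j → MvPolynomial.constantCoeff (f j) = 0
  variationalDeriv_eq : ∀ j, 1 ≤ j → ∀ g ∈ phaseSpace,
    variationalDeriv (f j) g = antideriv (kdvField a b j g)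

/-- `u`, with `u t x` the value at time `t` and position `x`, solves `u_t = V(u)`. -/
def IsSolution (V : (ℝ → ℝ) → (ℝ → ℝ)) (u : ℝ → ℝ → ℝ) : Prop :=
  ∀ t x, HasDerivAt (fun s => u s x) (V (u t) x) t

/-- `u` solves the standard KdV equation `u_t - 6 u u_x + u_xxx = 0`. -/
def IsKdVSolution (u : ℝ → ℝ → ℝ) : Prop :=
  ∀ t x, DifferentiableAt ℝ (fun s => u s x) t ∧
    deriv (fun s => u s x) t - 6 * u t x * deriv (u t) x + iteratedDeriv 3 (u t) x = 0

/-- `t ↦ u t` is a differentiable curve in the phase space, for its topology given by the seminorms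
`g ↦ ∫ |∂ₓⁿ g| dx`, `n = 0, 1, 2, …`. -/
def IsDifferentiableCurve (u : ℝ → ℝ → ℝ) : Prop :=
  (∀ t, u t ∈ phaseSpace) ∧ ∃ w : ℝ → ℝ → ℝ, (∀ t, w t ∈ phaseSpace) ∧
    ∀ (t : ℝ) (n : ℕ), Tendsto
      (fun s => ∫ x, |iteratedDeriv n (fun y => (u s y - u t y) / (s - t) - w t y) x|)
      (𝓝[≠] t) (𝓝 0)

/-- The Hamiltonian `H(g) = ∫ g³ + ½ (g_x)² dx` of the standard KdV equation. -/
def kdvHamiltonian (g : ℝ → ℝ) : ℝ := ∫ x, (g x ^ 3 + (1 / 2) * deriv g x ^ 2)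

end

/-! The two obstacles are that `𝒟⁻¹` stays local along the recursion and that each resulting
gradient is variational. Both are settled by one generating series `k = ∑ h_j z^j` of differential
polynomials, where `h_j = δf_{j+1}/δg`. With `p = 1 + a z k`, it solves the classical resolvent
equation `(1 - 2 a z u) p² - 2 b z p p'' + b z p'² = 1`, divided by `2 a z` so that it keeps its
meaning for `a = 0` (`IsResolvent`). A solution exists by `z`-adic contraction. Differentiating and
cancelling `p` gives the Lenard recursion (`IsResolvent.lenard`), so each right side is a total
derivative. An explicit density built from `k` has variation `k · δu` up to a total derivative
(`IsResolvent.density_variation`), which yields the `f_j`.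

Analytically, `ω(𝒟h, v) = ∫ h v` (`symplecticForm_deriv_left`), so Hamiltonian fields are `𝒟` of the
gradient, and `{F_{j+1}, F_{k+1}} = ∫ h_j 𝒟h_k`. Since `𝒟` and `a u 𝒟 + a 𝒟 u + b 𝒟³` are both
skew-adjoint, indices can be shifted from one factor to the other, and `h_j 𝒟h_k` is a total
derivative (`IsLenardSequence.exists_mul_totalDeriv`). Conservation along KdV then follows from the
chain rule for local functionals (`HasPhaseSpaceDerivAt.hasDerivAt_functional`). -/

/-! ### Derivations and fixed points in formal power series -/

/-- Coefficientwise extension of a derivation to formal power series. -/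
noncomputable def Derivation.powerSeriesMapCoeff {R A : Type*} [CommRing R] [CommRing A] [Algebra R A]
    (d : Derivation R A A) : Derivation R (PowerSeries A) (PowerSeries A) :=
  Derivation.mk'
    { toFun := fun p => PowerSeries.mk fun n => d (PowerSeries.coeff n p)
      map_add' := fun p q => by ext n; simp
      map_smul' := fun c p => by ext n; simp }
    (fun p q => by
      ext n
      simp only [LinearMap.coe_mk, AddHom.coe_mk, PowerSeries.coeff_mk, PowerSeries.coeff_mul,
        map_sum, Derivation.leibniz, smul_eq_mul, Finset.sum_add_distrib, map_add]
      rw [← Finset.Nat.sum_antidiagonal_swap (f := fun x : ℕ × ℕ =>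
        PowerSeries.coeff x.1 q * d (PowerSeries.coeff x.2 p))]
      simp)

@[simp]
theorem Derivation.coeff_powerSeriesMapCoeff {R A : Type*} [CommRing R] [CommRing A] [Algebra R A]
    (d : Derivation R A A) (n : ℕ) (p : PowerSeries A) :
    PowerSeries.coeff n (d.powerSeriesMapCoeff p) = d (PowerSeries.coeff n p) := by
  simp [Derivation.powerSeriesMapCoeff]

@[simp]
theorem Derivation.powerSeriesMapCoeff_X {R A : Type*} [CommRing R] [CommRing A] [Algebra R A]
    (d : Derivation R A A) : d.powerSeriesMapCoeff (PowerSeries.X : PowerSeries A) = 0 := by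
  ext n
  rw [d.coeff_powerSeriesMapCoeff, PowerSeries.coeff_X]
  split_ifs <;> simp

@[simp]
theorem Derivation.powerSeriesMapCoeff_C {R A : Type*} [CommRing R] [CommRing A] [Algebra R A]
    (d : Derivation R A A) (r : A) :
    d.powerSeriesMapCoeff (PowerSeries.C r) = PowerSeries.C (d r) := by
  ext n
  rw [d.coeff_powerSeriesMapCoeff, PowerSeries.coeff_C, PowerSeries.coeff_C]
  split_ifs <;> simp

theorem Derivation.X_pow_dvd_powerSeriesMapCoeff {R A : Type*} [CommRing R] [CommRing A]
    [Algebra R A] (d : Derivation R A A) {n : ℕ} {p : PowerSeries A} (h : PowerSeries.X ^ n ∣ p) :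
    PowerSeries.X ^ n ∣ d.powerSeriesMapCoeff p := by
  rw [PowerSeries.X_pow_dvd_iff] at h ⊢
  intro m hm
  simp [h m hm]

/-- A self-map of a power series ring that increases the order of differences has a fixed point. -/
theorem PowerSeries.exists_fixedPoint_of_contracting {A : Type*} [CommRing A]
    (Φ : PowerSeries A → PowerSeries A)
    (hΦ : ∀ n p q, (X : PowerSeries A) ^ n ∣ p - q → (X : PowerSeries A) ^ (n + 1) ∣ Φ p - Φ q) :
    ∃ p, Φ p = p := by
  have step : ∀ n, (X : PowerSeries A) ^ n ∣ Φ^[n + 1] 0 - Φ^[n] 0 := by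
    intro n
    induction n with
    | zero => simp
    | succ n ih =>
      rw [Function.iterate_succ_apply' Φ (n + 1), Function.iterate_succ_apply' Φ n]
      exact hΦ n _ _ (by simpa only [Function.iterate_succ_apply'] using ih)
  have far : ∀ n k, (X : PowerSeries A) ^ n ∣ Φ^[n + k] 0 - Φ^[n] 0 := by
    intro n k
    induction k with
    | zero => simp
    | succ k ih =>
      have := dvd_add ((pow_dvd_pow X (Nat.le_add_right n k)).trans (step (n + k))) ih
      simpa [add_assoc] using this
  -- From iterate `n + 1` on, the coefficient of index `n` no longer changes.
  let p : PowerSeries A := mk fun n => coeff n (Φ^[n + 1] 0)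
  have approx : ∀ n, (X : PowerSeries A) ^ n ∣ p - Φ^[n] 0 := by
    intro n
    rw [X_pow_dvd_iff]
    intro m hm
    obtain ⟨k, rfl⟩ := Nat.exists_eq_add_of_le (Nat.succ_le_of_lt hm)
    have := (X_pow_dvd_iff.1 (far (m + 1) k)) m (Nat.lt_succ_self m)
    rw [map_sub, sub_eq_zero] at this ⊢
    rw [this, coeff_mk]
  refine ⟨p, ?_⟩
  have key : ∀ n, (X : PowerSeries A) ^ (n + 1) ∣ Φ p - p := by
    intro n
    have h1 := hΦ n _ _ (approx n)
    rw [← Function.iterate_succ_apply' Φ] at h1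
    simpa using dvd_sub h1 (approx (n + 1))
  ext n
  have := (X_pow_dvd_iff.1 (key n)) n (Nat.lt_succ_self n)
  rwa [map_sub, sub_eq_zero] at this

/-! ### The resolvent equation -/

/-- The differential quadratic equation satisfied by the generating function of the hierarchy. Here
`θ` stands for `1 / 2`. -/
def IsResolvent {A : Type*} [CommRing A] (D : A → A) (θ a b z u k : A) : Prop :=
  k + θ * a * z * k ^ 2 = u * (1 + a * z * k) ^ 2 + b * z * D (D k)
    + a * b * z ^ 2 * (k * D (D k) - θ * D k ^ 2)

/-- Density of the Hamiltonians, as a function of the resolvent `k` and `w = (1 + a z k)⁻¹`. -/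
def resolventDensity {A : Type*} [CommRing A] (D : A → A) (θ a b z u k w : A) : A :=
  -θ * k ^ 2 + 2 * u * k + a * u * z * k ^ 2 + b * z * (k * D (D k) - θ * D k ^ 2) - k ^ 2 * w

section resolvent

variable {R A : Type*} [CommRing R] [CommRing A] [Algebra R A] {D d : Derivation R A A}
  {θ a b z u k w : A}

/-- The derivative of the quadratic equation is `1 + a z k` times this linear one, and `w` cancels
that factor. -/
theorem IsResolvent.lenard (h : IsResolvent D θ a b z u k) (h2 : 2 * θ = 1)
    (hθ : D θ = 0) (ha : D a = 0) (hb : D b = 0) (hz : D z = 0) (hw : (1 + a * z * k) * w = 1) :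
    D k = D u + z * (2 * a * u * D k + a * D u * k + b * D (D (D k))) := by
  have hD := congrArg D h
  simp only [map_add, map_sub, Derivation.leibniz, Derivation.leibniz_pow, smul_eq_mul,
    hθ, ha, hb, hz, Derivation.map_one_eq_zero, nsmul_eq_mul] at hD
  push_cast at hD
  simp only [pow_one, mul_zero, add_zero, zero_add] at hD
  linear_combination w * hD - (D k - D u - z * (2 * a * u * D k + a * D u * k + b * D (D (D k)))) * hw
    - w * (a * z * k * D k + a * b * z ^ 2 * D k * D (D k)) * h2

/-- Modulo the quadratic equation, `a z` times the density is `k w - u - b z D (D k)`, and `a z k w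
= 1 - w`. For invertible `a z` this is thus, up to scaling, a multiple of `u`, constants and total
derivatives, the classical density `1 / (1 + a z k)`. The form chosen never divides by `a z`. -/
theorem IsResolvent.density_variation (h : IsResolvent D θ a b z u k) (h2 : 2 * θ = 1)
    (hθ : d θ = 0) (ha : d a = 0) (hb : d b = 0) (hz : d z = 0)
    (ha' : D a = 0) (hz' : D z = 0)
    (hw : (1 + a * z * k) * w = 1) (comm : ∀ p, d (D p) = D (d p)) :
    d (resolventDensity D θ a b z u k w) = k * d u - b * z * D (w * D k * d k) := by
  have hd := congrArg d h
  have hwd : ∀ e : Derivation R A A, e a = 0 → e z = 0 → e w = - a * z * e k * w ^ 2 := by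
    intro e hea hez
    have := congrArg e hw
    simp only [map_add, Derivation.leibniz, smul_eq_mul, hea, hez,
      Derivation.map_one_eq_zero] at this
    linear_combination w * this - e w * hw
  have hdw := hwd d ha hz
  have hDw := hwd D ha' hz'
  have d2 : d 2 = 0 := by simpa using d.map_natCast 2
  unfold IsResolvent at h
  unfold resolventDensity
  simp only [map_add, map_sub, map_neg, Derivation.leibniz, Derivation.leibniz_pow, smul_eq_mul,
    hθ, ha, hb, hz, Derivation.map_one_eq_zero, nsmul_eq_mul, hdw, hDw, comm, d2] at hd ⊢
  push_cast at hd ⊢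
  simp only [pow_one, mul_zero, add_zero, zero_add] at hd ⊢
  linear_combination -k * w * hd - 2 * w ^ 2 * d k * h
    + (-k * d k - b * z * D k * D (d k) + k * w * (a * z * k * d k + a * b * z ^ 2 * D k * D (d k))
      + w ^ 2 * d k * (a * z * k ^ 2 + a * b * z ^ 2 * D k ^ 2)) * h2
    + (-d u * k * (1 + a * z * k) - 2 * u * d k * (1 + a * z * k) * (1 + w)
      - b * z * k * D (D (d k)) - b * z * d k * D (D k) * (1 + 2 * w) + b * z * D k * D (d k)
      + k * d k * (1 + 2 * w)) * hw

end resolvent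

/-! ### The algebra of differential polynomials -/

open MvPolynomial in
/-- The total derivative `∂ₓ` on differential polynomials. -/
noncomputable def totalDeriv : Derivation ℝ (MvPolynomial ℕ ℝ) (MvPolynomial ℕ ℝ) :=
  mkDerivation ℝ fun n => X (n + 1)

open MvPolynomial in
/-- The evolutionary derivation with characteristic `Q`: the directional derivative along `Q`. -/
noncomputable def evolutionaryDeriv (Q : MvPolynomial ℕ ℝ) :
    Derivation ℝ (MvPolynomial ℕ ℝ) (MvPolynomial ℕ ℝ) :=
  mkDerivation ℝ fun n => totalDeriv^[n] Q

@[simp]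
theorem totalDeriv_X (n : ℕ) : totalDeriv (MvPolynomial.X n) = MvPolynomial.X (n + 1) := by
  simp [totalDeriv]

@[simp]
theorem evolutionaryDeriv_X (Q : MvPolynomial ℕ ℝ) (n : ℕ) :
    evolutionaryDeriv Q (MvPolynomial.X n) = totalDeriv^[n] Q := by
  simp [evolutionaryDeriv]

/-- The commutator of two derivations is a derivation, and this one vanishes on the variables. -/
theorem evolutionaryDeriv_totalDeriv (Q p : MvPolynomial ℕ ℝ) :
    evolutionaryDeriv Q (totalDeriv p) = totalDeriv (evolutionaryDeriv Q p) := by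
  have h : ⁅evolutionaryDeriv Q, totalDeriv⁆ = 0 := by
    refine MvPolynomial.derivation_ext fun n => ?_
    simp [Derivation.commutator_apply, Function.iterate_succ_apply']
  have := congrArg (fun e : Derivation ℝ (MvPolynomial ℕ ℝ) (MvPolynomial ℕ ℝ) => e p) h
  simpa [Derivation.commutator_apply, sub_eq_zero] using this

@[simp]
theorem constantCoeff_totalDeriv (p : MvPolynomial ℕ ℝ) :
    MvPolynomial.constantCoeff (totalDeriv p) = 0 := by
  induction p using MvPolynomial.induction_on with
  | C a => simp [totalDeriv]
  | add p q hp hq => simp [hp, hq]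
  | mul_X p n hp => simp [hp]

theorem Derivation.finsetSum_apply {R A ι : Type*} [CommRing R] [CommRing A] [Algebra R A]
    (s : Finset ι) (e : ι → Derivation R A A) (p : A) : (∑ i ∈ s, e i) p = ∑ i ∈ s, e i p := by
  rw [← Finset.sum_apply]
  exact congrFun (map_sum Derivation.coeFnAddMonoidHom e s) p

theorem evolutionaryDeriv_eq_sum (Q f : MvPolynomial ℕ ℝ) :
    evolutionaryDeriv Q f = ∑ n ∈ f.vars, MvPolynomial.pderiv n f * totalDeriv^[n] Q := by
  have h := MvPolynomial.derivation_eqOn_supported (R := ℝ) (D₁ := evolutionaryDeriv Q)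
    (D₂ := ∑ n ∈ f.vars, (totalDeriv^[n] Q) • MvPolynomial.pderiv n) (s := (f.vars : Set ℕ))
    (fun i hi => by
      simp only [Function.comp_apply, evolutionaryDeriv_X, Derivation.finsetSum_apply,
        Derivation.smul_apply, MvPolynomial.pderiv_X, smul_eq_mul]
      rw [Finset.sum_eq_single i]
      · simp
      · intro n _ hn
        simp [hn.symm]
      · intro h
        exact absurd hi h)
    f.mem_supported_vars
  rw [h]
  simp [Derivation.finsetSum_apply, mul_comm]

/-- The variational derivative as a differential polynomial. -/
noncomputable def eulerOperator (f : MvPolynomial ℕ ℝ) : MvPolynomial ℕ ℝ :=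
  ∑ n ∈ f.vars, (-1) ^ n * totalDeriv^[n] (MvPolynomial.pderiv n f)

theorem exists_mul_iterate_totalDeriv_sub (n : ℕ) (p q : MvPolynomial ℕ ℝ) :
    ∃ r, p * totalDeriv^[n] q - (-1) ^ n * totalDeriv^[n] p * q = totalDeriv r := by
  induction n generalizing p with
  | zero => exact ⟨0, by simp⟩
  | succ n ih =>
    obtain ⟨r, hr⟩ := ih (totalDeriv p)
    refine ⟨p * totalDeriv^[n] q - r, ?_⟩
    rw [map_sub, ← hr, Derivation.leibniz, Function.iterate_succ_apply', Function.iterate_succ_apply]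
    simp only [smul_eq_mul]
    ring

/-- Formal integration by parts, term by term; `r` collects the boundary terms. -/
theorem exists_evolutionaryDeriv_sub_eulerOperator (Q f : MvPolynomial ℕ ℝ) :
    ∃ r, evolutionaryDeriv Q f - eulerOperator f * Q = totalDeriv r := by
  choose r hr using fun n => exists_mul_iterate_totalDeriv_sub n (MvPolynomial.pderiv n f) Q
  refine ⟨∑ n ∈ f.vars, r n, ?_⟩
  simp only [map_sum, ← hr, evolutionaryDeriv_eq_sum, eulerOperator, Finset.sum_sub_distrib,
    Finset.sum_mul]

/-! ### Existence of the hierarchy -/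

/-- The generating series of the hierarchy. -/
theorem exists_isResolvent (θ a b : ℝ) : ∃ k : PowerSeries (MvPolynomial ℕ ℝ),
    IsResolvent totalDeriv.powerSeriesMapCoeff (algebraMap ℝ _ θ) (algebraMap ℝ _ a)
      (algebraMap ℝ _ b) PowerSeries.X (PowerSeries.C (MvPolynomial.X 0)) k := by
  set D := totalDeriv.powerSeriesMapCoeff
  set z : PowerSeries (MvPolynomial ℕ ℝ) := PowerSeries.X
  set u : PowerSeries (MvPolynomial ℕ ℝ) := PowerSeries.C (MvPolynomial.X 0)
  set θ' := algebraMap ℝ (PowerSeries (MvPolynomial ℕ ℝ)) θ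
  set a' := algebraMap ℝ (PowerSeries (MvPolynomial ℕ ℝ)) a
  set b' := algebraMap ℝ (PowerSeries (MvPolynomial ℕ ℝ)) b
  -- Solved for its bare term `k`, the equation has a factor `z` at every other occurrence of `k`;
  -- this makes the map contracting.
  obtain ⟨k, hk⟩ := PowerSeries.exists_fixedPoint_of_contracting
    (fun k => u * (1 + a' * z * k) ^ 2 + b' * z * D (D k)
      + a' * b' * z ^ 2 * (k * D (D k) - θ' * D k ^ 2) - θ' * a' * z * k ^ 2) (by
      intro n p q h
      have h1 := totalDeriv.X_pow_dvd_powerSeriesMapCoeff h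
      have h2 := totalDeriv.X_pow_dvd_powerSeriesMapCoeff h1
      obtain ⟨r, hr⟩ := h
      obtain ⟨r1, hr1⟩ := h1
      obtain ⟨r2, hr2⟩ := h2
      simp only [map_sub] at hr1 hr2
      refine ⟨u * a' * r * (2 + a' * z * (p + q)) + b' * r2
        + a' * b' * z * (r * D (D p) + q * r2 - θ' * r1 * (D p + D q)) - θ' * a' * r * (p + q), ?_⟩
      change _ = z ^ (n + 1) * _
      change p - q = z ^ n * r at hr
      change D p - D q = z ^ n * r1 at hr1
      change D (D p) - D (D q) = z ^ n * r2 at hr2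
      linear_combination (u * a' * z * (2 + a' * z * (p + q)) + a' * b' * z ^ 2 * D (D p)
        - θ' * a' * z * (p + q)) * hr + (b' * z + a' * b' * z ^ 2 * q) * hr2
        - a' * b' * z ^ 2 * θ' * (D p + D q) * hr1)
  exact ⟨k, by unfold IsResolvent; linear_combination -hk⟩

/-- Constant terms must vanish for the `h_j` to be integrable and to be the antiderivatives that
vanish at `-∞`. Setting all jet variables to zero leaves `κ (1 + θ a z κ) = 0`, whose second factor
has constant coefficient `1`. -/
theorem IsResolvent.map_constantCoeff {θ a b : ℝ} {k : PowerSeries (MvPolynomial ℕ ℝ)}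
    (hk : IsResolvent totalDeriv.powerSeriesMapCoeff (algebraMap ℝ _ θ) (algebraMap ℝ _ a)
      (algebraMap ℝ _ b) PowerSeries.X (PowerSeries.C (MvPolynomial.X 0)) k) :
    PowerSeries.map MvPolynomial.constantCoeff k = 0 := by
  have hD : ∀ p, PowerSeries.map MvPolynomial.constantCoeff
      (totalDeriv.powerSeriesMapCoeff p) = 0 := fun p => by
    ext n
    simp
  have h := congrArg (PowerSeries.map (MvPolynomial.constantCoeff : MvPolynomial ℕ ℝ →+* ℝ)) hk
  simp only [map_add, map_sub, map_mul, map_pow, hD, PowerSeries.map_C, PowerSeries.map_X,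
    MvPolynomial.constantCoeff_X, map_zero] at h
  set κ := PowerSeries.map (MvPolynomial.constantCoeff : MvPolynomial ℕ ℝ →+* ℝ) k
  set t := PowerSeries.map (MvPolynomial.constantCoeff : MvPolynomial ℕ ℝ →+* ℝ)
    (algebraMap ℝ _ θ)
  set α := PowerSeries.map (MvPolynomial.constantCoeff : MvPolynomial ℕ ℝ →+* ℝ)
    (algebraMap ℝ _ a)
  have h' : κ * (1 + PowerSeries.X * (t * α * κ)) = 0 := by linear_combination h
  refine (mul_eq_zero.1 h').resolve_right fun h0 => ?_
  have := congrArg (PowerSeries.constantCoeff (R := ℝ)) h0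
  simp at this

theorem exists_hierarchy (a b : ℝ) : ∃ h f : ℕ → MvPolynomial ℕ ℝ,
    h 0 = MvPolynomial.X 0 ∧ f 0 = MvPolynomial.C (1 / 2) * MvPolynomial.X 0 ^ 2 ∧
    (∀ j, MvPolynomial.constantCoeff (h j) = 0) ∧ (∀ j, MvPolynomial.constantCoeff (f j) = 0) ∧
    (∀ j, totalDeriv (h (j + 1)) = 2 * MvPolynomial.C a * MvPolynomial.X 0 * totalDeriv (h j)
      + MvPolynomial.C a * MvPolynomial.X 1 * h j
      + MvPolynomial.C b * totalDeriv (totalDeriv (totalDeriv (h j)))) ∧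
    ∀ Q j, ∃ r, evolutionaryDeriv Q (f j) - h j * Q = totalDeriv r := by
  obtain ⟨k, hk⟩ := exists_isResolvent (1 / 2) a b
  have hκ := hk.map_constantCoeff
  have h2 : (2 : PowerSeries (MvPolynomial ℕ ℝ)) * algebraMap ℝ _ (1 / 2) = 1 := by
    rw [← map_ofNat (algebraMap ℝ (PowerSeries (MvPolynomial ℕ ℝ))) 2, ← map_mul]
    norm_num
  have halg : ∀ r : ℝ, algebraMap ℝ (PowerSeries (MvPolynomial ℕ ℝ)) r
      = PowerSeries.C (MvPolynomial.C r) := fun r => by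
    rw [PowerSeries.algebraMap_apply, MvPolynomial.algebraMap_eq]
  obtain ⟨w, hw⟩ : ∃ w, (1 + algebraMap ℝ _ a * PowerSeries.X * k) * w = 1 := by
    have : IsUnit (1 + algebraMap ℝ _ a * PowerSeries.X * k) := by
      rw [PowerSeries.isUnit_iff_constantCoeff]
      simp
    exact this.exists_right_inv
  have hk0 : PowerSeries.coeff 0 k = MvPolynomial.X 0 := by
    have := congrArg (PowerSeries.coeff 0) hk
    simpa using this
  have hw0 : PowerSeries.coeff 0 w = 1 := by
    have := congrArg (PowerSeries.coeff 0) hw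
    simpa using this
  have hD : ∀ p, PowerSeries.map MvPolynomial.constantCoeff
      (totalDeriv.powerSeriesMapCoeff p) = 0 := fun p => by
    ext n
    simp
  refine ⟨fun j => PowerSeries.coeff j k, fun j => PowerSeries.coeff j (resolventDensity
    totalDeriv.powerSeriesMapCoeff (algebraMap ℝ _ (1 / 2)) (algebraMap ℝ _ a)
      (algebraMap ℝ _ b) PowerSeries.X (PowerSeries.C (MvPolynomial.X 0)) k w),
      hk0, ?_, ?_, ?_, ?_, ?_⟩
  · simp [resolventDensity, halg] at hk0 hw0 ⊢
    rw [hk0, hw0, map_ofNat (PowerSeries.constantCoeff (R := MvPolynomial ℕ ℝ)) 2]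
    have : (MvPolynomial.C (1 / 2) : MvPolynomial ℕ ℝ) * 2 = 1 := by
      rw [← map_ofNat (MvPolynomial.C (σ := ℕ) (R := ℝ)) 2, ← map_mul]
      norm_num
    simp at this
    linear_combination (-MvPolynomial.X 0 ^ 2) * this
  · intro j
    simpa using congrArg (PowerSeries.coeff j) hκ
  · intro j
    rw [← PowerSeries.coeff_map]
    simp [resolventDensity, hκ, hD]
  · intro j
    have := congrArg (PowerSeries.coeff (j + 1)) (hk.lenard h2 (by simp) (by simp) (by simp)
      (by simp) hw)
    rw [map_add, PowerSeries.coeff_succ_X_mul] at this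
    simp only [halg, Derivation.coeff_powerSeriesMapCoeff, Derivation.powerSeriesMapCoeff_C,
      PowerSeries.coeff_succ_C, totalDeriv_X, map_add, mul_assoc, PowerSeries.coeff_C_mul,
      zero_add] at this
    rw [this, ← map_ofNat (PowerSeries.C (R := MvPolynomial ℕ ℝ)) 2, PowerSeries.coeff_C_mul,
      PowerSeries.coeff_C_mul]
    simp [mul_assoc]
  · intro Q j
    have := congrArg (PowerSeries.coeff j) (hk.density_variation
      (d := (evolutionaryDeriv Q).powerSeriesMapCoeff) h2 (by simp) (by simp) (by simp)
      (by simp) (by simp) (by simp) hw (fun p => by ext; simp [evolutionaryDeriv_totalDeriv]))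
    rw [Derivation.coeff_powerSeriesMapCoeff, map_sub, Derivation.powerSeriesMapCoeff_C,
      PowerSeries.coeff_mul_C, evolutionaryDeriv_X, Function.iterate_zero_apply] at this
    -- The witness is the divergence term of `IsResolvent.density_variation`.
    refine ⟨-PowerSeries.coeff j (algebraMap ℝ _ b * PowerSeries.X *
      (w * totalDeriv.powerSeriesMapCoeff k * (evolutionaryDeriv Q).powerSeriesMapCoeff k)), ?_⟩
    rw [this, map_neg, ← Derivation.coeff_powerSeriesMapCoeff]
    simp only [Derivation.leibniz _ (_ * PowerSeries.X)]
    simp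

/-! ### Calculus in the phase space -/

section phaseSpace

variable {g : ℝ → ℝ}

theorem hasDerivAt_iteratedDeriv_of_mem_phaseSpace (hg : g ∈ phaseSpace) (n : ℕ) (x : ℝ) :
    HasDerivAt (iteratedDeriv n g) (iteratedDeriv (n + 1) g x) x := by
  rw [iteratedDeriv_succ]
  exact ((hg.1.differentiable_iteratedDeriv n (by exact_mod_cast WithTop.coe_lt_top n)) x).hasDerivAt

theorem hasDerivAt_of_mem_phaseSpace (hg : g ∈ phaseSpace) (x : ℝ) :
    HasDerivAt g (deriv g x) x := by
  simpa using hasDerivAt_iteratedDeriv_of_mem_phaseSpace hg 0 x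

theorem deriv_mem_phaseSpace (hg : g ∈ phaseSpace) : deriv g ∈ phaseSpace := by
  refine ⟨(contDiff_infty_iff_deriv.1 hg.1).2, fun n => ?_⟩
  rw [← iteratedDeriv_succ']
  exact hg.2 (n + 1)

theorem iteratedDeriv_mem_phaseSpace (hg : g ∈ phaseSpace) (n : ℕ) :
    iteratedDeriv n g ∈ phaseSpace := by
  induction n with
  | zero => simpa using hg
  | succ n ih =>
    rw [iteratedDeriv_succ]
    exact deriv_mem_phaseSpace ih

theorem integrable_of_mem_phaseSpace (hg : g ∈ phaseSpace) : Integrable g := by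
  simpa using hg.2 0

theorem continuous_of_mem_phaseSpace (hg : g ∈ phaseSpace) : Continuous g := hg.1.continuous

theorem tendsto_atBot_of_mem_phaseSpace (hg : g ∈ phaseSpace) : Tendsto g atBot (𝓝 0) :=
  tendsto_zero_of_hasDerivAt_of_integrableOn_Iic (a := 0)
    (fun x _ => hasDerivAt_of_mem_phaseSpace hg x)
    (integrable_of_mem_phaseSpace (deriv_mem_phaseSpace hg)).integrableOn
    (integrable_of_mem_phaseSpace hg).integrableOn

theorem antideriv_deriv (hg : g ∈ phaseSpace) : antideriv (deriv g) = g := by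
  ext x
  rw [antideriv, integral_Iic_of_hasDerivAt_of_tendsto'
    (fun x _ => hasDerivAt_of_mem_phaseSpace hg x)
    (integrable_of_mem_phaseSpace (deriv_mem_phaseSpace hg)).integrableOn
    (tendsto_atBot_of_mem_phaseSpace hg), sub_zero]

theorem norm_antideriv_le {h : ℝ → ℝ} (hh : Integrable h) (x : ℝ) :
    ‖antideriv h x‖ ≤ ∫ y, |h y| :=
  (norm_integral_le_integral_norm _).trans
    (setIntegral_le_integral hh.norm (.of_forall fun _ => norm_nonneg _))

/-- This makes the `L¹` seminorms control sup norms, at the cost of one derivative; all products are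
bounded this way. -/
theorem norm_le_integral_deriv (hg : g ∈ phaseSpace) (x : ℝ) : ‖g x‖ ≤ ∫ y, |deriv g y| := by
  have := norm_antideriv_le (integrable_of_mem_phaseSpace (deriv_mem_phaseSpace hg)) x
  rwa [antideriv_deriv hg] at this

theorem memLp_top_of_mem_phaseSpace (hg : g ∈ phaseSpace) : MemLp g ⊤ :=
  memLp_top_of_bound (continuous_of_mem_phaseSpace hg).aestronglyMeasurable _
    (.of_forall (norm_le_integral_deriv hg))

theorem integral_deriv_eq_zero (hg : g ∈ phaseSpace) : ∫ x, deriv g x = 0 :=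
  integral_eq_zero_of_hasDerivAt_of_integrable (hasDerivAt_of_mem_phaseSpace hg)
    (integrable_of_mem_phaseSpace (deriv_mem_phaseSpace hg)) (integrable_of_mem_phaseSpace hg)

theorem hasDerivAt_antideriv (hg : g ∈ phaseSpace) (x : ℝ) :
    HasDerivAt (antideriv g) (g x) x := by
  have h : antideriv g = fun x => (∫ y in Set.Iic 0, g y) + ∫ y in (0 : ℝ)..x, g y := by
    ext x
    rw [antideriv, ← intervalIntegral.integral_Iic_sub_Iic
      (integrable_of_mem_phaseSpace hg).integrableOn (integrable_of_mem_phaseSpace hg).integrableOn]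
    ring
  rw [h]
  exact ((continuous_of_mem_phaseSpace hg).integral_hasStrictDerivAt 0 x).hasDerivAt.const_add _

end phaseSpace

/-! ### Differential polynomials evaluated on the phase space -/

section evalJet

open MvPolynomial

variable {g v : ℝ → ℝ}

@[simp]
theorem evalJet_C (r : ℝ) (g : ℝ → ℝ) : evalJet (C r) g = fun _ => r := by
  ext x; simp [evalJet]

@[simp]
theorem evalJet_zero (g : ℝ → ℝ) : evalJet 0 g = 0 := by
  ext x; simp [evalJet]

@[simp]
theorem evalJet_X (n : ℕ) (g : ℝ → ℝ) : evalJet (X n) g = iteratedDeriv n g := by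
  ext x; simp [evalJet]

@[simp]
theorem evalJet_add (p q : MvPolynomial ℕ ℝ) (g : ℝ → ℝ) :
    evalJet (p + q) g = fun x => evalJet p g x + evalJet q g x := by
  ext x; simp [evalJet]

@[simp]
theorem evalJet_sub (p q : MvPolynomial ℕ ℝ) (g : ℝ → ℝ) :
    evalJet (p - q) g = fun x => evalJet p g x - evalJet q g x := by
  ext x; simp [evalJet]

@[simp]
theorem evalJet_mul (p q : MvPolynomial ℕ ℝ) (g : ℝ → ℝ) :
    evalJet (p * q) g = fun x => evalJet p g x * evalJet q g x := by
  ext x; simp [evalJet]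

theorem hasDerivAt_evalJet (hg : g ∈ phaseSpace) (p : MvPolynomial ℕ ℝ) (x : ℝ) :
    HasDerivAt (evalJet p g) (evalJet (totalDeriv p) g x) x := by
  induction p using MvPolynomial.induction_on with
  | C a => simpa [totalDeriv] using hasDerivAt_const x a
  | add p q hp hq =>
    simp only [evalJet_add, map_add]
    exact hp.add hq
  | mul_X p n hp =>
    have := hp.mul (hasDerivAt_iteratedDeriv_of_mem_phaseSpace hg n x)
    simp only [evalJet_mul, Derivation.leibniz, evalJet_X, totalDeriv_X, evalJet_add, smul_eq_mul]
    exact this.congr_deriv (by ring)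

theorem deriv_evalJet (hg : g ∈ phaseSpace) (p : MvPolynomial ℕ ℝ) :
    deriv (evalJet p g) = evalJet (totalDeriv p) g :=
  funext fun x => (hasDerivAt_evalJet hg p x).deriv

theorem iteratedDeriv_evalJet (hg : g ∈ phaseSpace) (n : ℕ) (p : MvPolynomial ℕ ℝ) :
    iteratedDeriv n (evalJet p g) = evalJet (totalDeriv^[n] p) g := by
  induction n with
  | zero => simp
  | succ n ih => rw [iteratedDeriv_succ, ih, deriv_evalJet hg, Function.iterate_succ_apply']

theorem contDiff_evalJet (hg : g ∈ phaseSpace) (p : MvPolynomial ℕ ℝ) :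
    ContDiff ℝ ∞ (evalJet p g) := by
  refine contDiff_of_differentiable_iteratedDeriv fun n _ x => ?_
  rw [iteratedDeriv_evalJet hg]
  exact (hasDerivAt_evalJet hg _ x).differentiableAt

theorem memLp_top_evalJet (hg : g ∈ phaseSpace) (p : MvPolynomial ℕ ℝ) :
    MemLp (evalJet p g) ⊤ := by
  induction p using MvPolynomial.induction_on with
  | C a => simpa using memLp_top_const a
  | add p q hp hq => simpa using! hp.add hq
  | mul_X p n hp =>
    simpa using (memLp_top_of_mem_phaseSpace (iteratedDeriv_mem_phaseSpace hg n)).mul' hp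

theorem MeasureTheory.MemLp.integrable_mul_of_top {A B : ℝ → ℝ} (hA : MemLp A ⊤)
    (hB : Integrable B) : Integrable fun x => A x * B x :=
  memLp_one_iff_integrable.1 ((memLp_one_iff_integrable.2 hB).mul' hA)

theorem integrable_evalJet_sub_constantCoeff (hg : g ∈ phaseSpace) (p : MvPolynomial ℕ ℝ) :
    Integrable fun x => evalJet p g x - constantCoeff p := by
  induction p using MvPolynomial.induction_on with
  | C a => simp
  | add p q hp hq =>
    refine (hp.add hq).congr (.of_forall fun x => ?_)
    simp only [Pi.add_apply, evalJet_add, map_add]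
    ring
  | mul_X p n hp => simpa using (memLp_top_evalJet hg p).integrable_mul_of_top (hg.2 n)

theorem integrable_evalJet (hg : g ∈ phaseSpace) {p : MvPolynomial ℕ ℝ}
    (hp : constantCoeff p = 0) : Integrable (evalJet p g) := by
  simpa [hp] using integrable_evalJet_sub_constantCoeff hg p

theorem constantCoeff_iterate_totalDeriv {p : MvPolynomial ℕ ℝ} (hp : constantCoeff p = 0)
    (n : ℕ) : constantCoeff (totalDeriv^[n] p) = 0 := by
  cases n with
  | zero => simpa
  | succ n => simp [Function.iterate_succ_apply']

theorem evalJet_mem_phaseSpace (hg : g ∈ phaseSpace) {p : MvPolynomial ℕ ℝ}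
    (hp : constantCoeff p = 0) : evalJet p g ∈ phaseSpace := by
  refine ⟨contDiff_evalJet hg p, fun n => ?_⟩
  rw [iteratedDeriv_evalJet hg]
  exact integrable_evalJet hg (constantCoeff_iterate_totalDeriv hp n)

theorem integral_evalJet_totalDeriv (hg : g ∈ phaseSpace) (p : MvPolynomial ℕ ℝ) :
    ∫ x, evalJet (totalDeriv p) g x = 0 := by
  -- Removing the constant term puts the function in the phase space and does not change its
  -- derivative.
  have h := integral_deriv_eq_zero (evalJet_mem_phaseSpace hg
    (p := p - C (constantCoeff p)) (by simp))
  rw [deriv_evalJet hg] at h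
  simpa [totalDeriv] using h

theorem evalJet_finsetSum {ι : Type*} (s : Finset ι) (p : ι → MvPolynomial ℕ ℝ) (g : ℝ → ℝ)
    (x : ℝ) : evalJet (∑ i ∈ s, p i) g x = ∑ i ∈ s, evalJet (p i) g x := by
  simp [evalJet]

theorem variationalDeriv_eq_evalJet (hg : g ∈ phaseSpace) (f : MvPolynomial ℕ ℝ) :
    variationalDeriv f g = evalJet (eulerOperator f) g := by
  ext x
  rw [variationalDeriv, eulerOperator, evalJet_finsetSum]
  refine Finset.sum_congr rfl fun n _ => ?_
  rw [iteratedDeriv_evalJet hg]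
  simp [evalJet]

/-- A differential polynomial all of whose multiples are total derivatives vanishes on the phase
space. -/
theorem evalJet_eq_zero_of_forall_mul {p : MvPolynomial ℕ ℝ}
    (h : ∀ Q, ∃ r, p * Q = totalDeriv r) (hg : g ∈ phaseSpace) : evalJet p g = 0 := by
  have hp : constantCoeff p = 0 := by
    obtain ⟨r, hr⟩ := h 1
    rw [← mul_one p, hr, constantCoeff_totalDeriv]
  -- The multiplier `Q = p` gives `∫ p² = 0`. The choice `Q = 1` above removed the constant term, so
  -- that `p²` is integrable.
  obtain ⟨r, hr⟩ := h p
  have h0 := integral_evalJet_totalDeriv hg r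
  rw [← hr, integral_eq_zero_iff_of_nonneg (fun x => by simpa using mul_self_nonneg _)
    (integrable_evalJet hg (by simp [hp]))] at h0
  have := Continuous.ae_eq_iff_eq volume (contDiff_evalJet hg _).continuous continuous_zero |>.1 h0
  ext x
  simpa using congrFun this x

/-- The gradient is unique modulo total derivatives: `eulerOperator f - h` times any `Q` is a total
derivative. Gradients can thus be certified without computing the Euler sum. -/
theorem variationalDeriv_eq_of_evolutionaryDeriv {f h : MvPolynomial ℕ ℝ}
    (H : ∀ Q, ∃ r, evolutionaryDeriv Q f - h * Q = totalDeriv r) (hg : g ∈ phaseSpace) :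
    variationalDeriv f g = evalJet h g := by
  rw [variationalDeriv_eq_evalJet hg]
  have := evalJet_eq_zero_of_forall_mul (p := eulerOperator f - h) (fun Q => by
    obtain ⟨r, hr⟩ := H Q
    obtain ⟨r', hr'⟩ := exists_evolutionaryDeriv_sub_eulerOperator Q f
    exact ⟨r - r', by rw [map_sub, ← hr, ← hr']; ring⟩) hg
  ext x
  simpa [sub_eq_zero] using congrFun this x

/-- Repeated integration by parts. -/
theorem integral_evalJet_mul_iteratedDeriv (hg : g ∈ phaseSpace) (hv : v ∈ phaseSpace) (n : ℕ)
    (p : MvPolynomial ℕ ℝ) :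
    ∫ x, evalJet p g x * iteratedDeriv n v x
      = ∫ x, (-1) ^ n * evalJet (totalDeriv^[n] p) g x * v x := by
  induction n generalizing p with
  | zero => simp
  | succ n ih =>
    rw [integral_mul_deriv_eq_deriv_mul_of_integrable (u' := evalJet (totalDeriv p) g)
      (v := iteratedDeriv n v) (fun x _ => hasDerivAt_evalJet hg p x)
      (fun x _ => hasDerivAt_iteratedDeriv_of_mem_phaseSpace hv n x)
      ((memLp_top_evalJet hg _).integrable_mul_of_top (hv.2 _))
      ((memLp_top_evalJet hg _).integrable_mul_of_top (hv.2 _))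
      ((memLp_top_evalJet hg _).integrable_mul_of_top (hv.2 _)), ih, ← integral_neg]
    simp [pow_succ]

theorem integral_sum_pderiv_mul_iteratedDeriv (hg : g ∈ phaseSpace) (hv : v ∈ phaseSpace)
    (f : MvPolynomial ℕ ℝ) :
    ∫ x, ∑ n ∈ f.vars, evalJet (pderiv n f) g x * iteratedDeriv n v x
      = ∫ x, variationalDeriv f g x * v x := by
  rw [integral_finsetSum _ fun n _ => (memLp_top_evalJet hg _).integrable_mul_of_top (hv.2 n)]
  simp only [integral_evalJet_mul_iteratedDeriv hg hv, variationalDeriv, Finset.sum_mul,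
    iteratedDeriv_evalJet hg]
  rw [integral_finsetSum]
  intro n _
  simp only [mul_assoc]
  exact ((memLp_top_evalJet hg _).integrable_mul_of_top (integrable_of_mem_phaseSpace hv)).const_mul _

end evalJet

/-! ### The symplectic form and Hamiltonian vector fields -/

section symplecticForm

variable {g h u v w : ℝ → ℝ}

theorem symplecticForm_eq (hu : Integrable u) (hv : Integrable v) :
    symplecticForm u v = (1 / 2) * ∫ x, (v x * antideriv u x - u x * antideriv v x) := by
  rw [symplecticForm]
  congr 2
  ext x
  rw [integral_sub (hu.integrableOn.const_mul _) (hv.integrableOn.const_mul _),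
    integral_const_mul, integral_const_mul, antideriv, antideriv]

theorem symplecticForm_swap (u v : ℝ → ℝ) : symplecticForm u v = -symplecticForm v u := by
  rw [symplecticForm, symplecticForm, ← mul_neg, ← integral_neg]
  congr 2
  ext x
  rw [← integral_neg]
  congr 1
  ext y
  ring

/-- Integrating `antideriv v * deriv h` by parts makes the two halves of the form equal. -/
theorem symplecticForm_deriv_left (hh : h ∈ phaseSpace) (hv : v ∈ phaseSpace) :
    symplecticForm (deriv h) v = ∫ x, h x * v x := by
  have iv := integrable_of_mem_phaseSpace hv
  have ih := integrable_of_mem_phaseSpace (deriv_mem_phaseSpace hh)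
  have hV : MemLp (antideriv v) ⊤ := memLp_top_of_bound
    (continuous_iff_continuousAt.2 fun x =>
      (hasDerivAt_antideriv hv x).continuousAt).aestronglyMeasurable _
    (.of_forall (norm_antideriv_le iv))
  have i1 : Integrable fun x => h x * v x :=
    (memLp_top_of_mem_phaseSpace hh).integrable_mul_of_top iv
  have i2 : Integrable fun x => antideriv v x * deriv h x := hV.integrable_mul_of_top ih
  have parts := integral_mul_deriv_eq_deriv_mul_of_integrable (u := antideriv v) (u' := v)
    (v := h) (v' := deriv h) (fun x _ => hasDerivAt_antideriv hv x)
    (fun x _ => hasDerivAt_of_mem_phaseSpace hh x) i2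
    ((memLp_top_of_mem_phaseSpace hv).integrable_mul_of_top (integrable_of_mem_phaseSpace hh))
    (hV.integrable_mul_of_top (integrable_of_mem_phaseSpace hh))
  rw [symplecticForm_eq ih iv, antideriv_deriv hh]
  simp only [mul_comm _ (antideriv v _), mul_comm (v _) (h _)] at parts ⊢
  rw [integral_sub i1 i2, parts]
  ring

theorem eq_of_forall_symplecticForm_eq (hu : u ∈ phaseSpace) (hw : w ∈ phaseSpace)
    (h : ∀ v ∈ phaseSpace, symplecticForm u v = symplecticForm w v) : u = w := by
  have hd : u - w ∈ phaseSpace := phaseSpace.sub_mem hu hw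
  have hb := memLp_top_of_mem_phaseSpace hd
  -- Testing against `v = (u - w)'` turns the hypothesis into `∫ (u - w)² = 0`.
  have h1 := h _ (deriv_mem_phaseSpace hd)
  rw [symplecticForm_swap, symplecticForm_deriv_left hd hu, symplecticForm_swap w,
    symplecticForm_deriv_left hd hw, neg_inj, ← sub_eq_zero,
    ← integral_sub (hb.integrable_mul_of_top (integrable_of_mem_phaseSpace hu))
      (hb.integrable_mul_of_top (integrable_of_mem_phaseSpace hw))] at h1
  have h2 : ∫ x, (u - w) x * (u - w) x = 0 := by
    simpa [mul_sub] using h1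
  rw [integral_eq_zero_iff_of_nonneg (fun x => mul_self_nonneg _)
    (hb.integrable_mul_of_top (integrable_of_mem_phaseSpace hd))] at h2
  have hc := continuous_of_mem_phaseSpace hd
  have := Continuous.ae_eq_iff_eq volume (hc.mul hc) continuous_zero |>.1 h2
  ext x
  simpa [sub_eq_zero] using congrFun this x

theorem hamiltonianVectorField_eq {K : (ℝ → ℝ) → ℝ} (hw : IsHamiltonianVectorAt K g w) :
    hamiltonianVectorField K g = w := by
  have h : ∃ w, IsHamiltonianVectorAt K g w := ⟨w, hw⟩
  rw [hamiltonianVectorField, dif_pos h]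
  exact eq_of_forall_symplecticForm_eq h.choose_spec.1 hw.1 fun v hv =>
    (h.choose_spec.2 v hv).unique (hw.2 v hv)

end symplecticForm

/-! ### Differentiation in `L¹` and `L^∞` -/

/-- The family `A s` of bounded functions on `ℝ` has derivative `A'` at `s = t`, with difference
quotients converging both in `L¹` and in `L^∞`. -/
structure HasLpDerivAt (A : ℝ → ℝ → ℝ) (A' : ℝ → ℝ) (t : ℝ) : Prop where
  memLp_top : ∀ s, MemLp (A s) ⊤
  deriv_memLp_top : MemLp A' ⊤
  deriv_integrable : Integrable A'
  tendsto : ∀ p : ENNReal, p = 1 ∨ p = ⊤ → Tendsto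
    (fun s => eLpNorm (fun x => (A s x - A t x) / (s - t) - A' x) p) (𝓝[≠] t) (𝓝 0)

namespace HasLpDerivAt

variable {A B : ℝ → ℝ → ℝ} {A' B' : ℝ → ℝ} {t : ℝ}

theorem aestronglyMeasurable (hA : HasLpDerivAt A A' t) (s : ℝ) :
    AEStronglyMeasurable (fun x => (A s x - A t x) / (s - t) - A' x) := by
  have h1 := ((hA.memLp_top s).1.sub (hA.memLp_top t).1).const_mul ((s - t)⁻¹)
  refine (h1.sub hA.deriv_memLp_top.1).congr (.of_forall fun x => ?_)
  simp [div_eq_inv_mul]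

theorem deriv_memLp (hA : HasLpDerivAt A A' t) {p : ENNReal} (hp : p = 1 ∨ p = ⊤) :
    MemLp A' p := by
  rcases hp with rfl | rfl
  · exact memLp_one_iff_integrable.2 hA.deriv_integrable
  · exact hA.deriv_memLp_top

theorem const (c : ℝ) (t : ℝ) : HasLpDerivAt (fun _ _ => c) (fun _ => 0) t where
  memLp_top _ := memLp_top_const c
  deriv_memLp_top := memLp_top_const 0
  deriv_integrable := integrable_zero _ _ _
  tendsto p _ := by simp

theorem add (hA : HasLpDerivAt A A' t) (hB : HasLpDerivAt B B' t) :
    HasLpDerivAt (fun s x => A s x + B s x) (fun x => A' x + B' x) t where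
  memLp_top s := (hA.memLp_top s).add (hB.memLp_top s)
  deriv_memLp_top := hA.deriv_memLp_top.add hB.deriv_memLp_top
  deriv_integrable := hA.deriv_integrable.add hB.deriv_integrable
  tendsto p hp := by
    refine tendsto_of_tendsto_of_tendsto_of_le_of_le tendsto_const_nhds
      (by simpa using (hA.tendsto p hp).add (hB.tendsto p hp)) (fun _ => zero_le) fun s => ?_
    refine le_trans (le_of_eq ?_) (eLpNorm_add_le (hA.aestronglyMeasurable s)
      (hB.aestronglyMeasurable s) (by rcases hp with rfl | rfl <;> simp))
    congr 1
    ext x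
    simp only [Pi.add_apply]
    ring

theorem tendsto_sub (hA : HasLpDerivAt A A' t) :
    Tendsto (fun s => eLpNorm (fun x => A s x - A t x) ⊤) (𝓝[≠] t) (𝓝 0) := by
  have hst : Tendsto (fun s => ‖s - t‖ₑ) (𝓝[≠] t) (𝓝 0) := by
    have : Tendsto (fun s : ℝ => ‖s - t‖ₑ) (𝓝 t) (𝓝 ‖t - t‖ₑ) := by
      exact (continuous_id.sub continuous_const).enorm.tendsto t
    simpa using this.mono_left nhdsWithin_le_nhds
  have hlim : Tendsto (fun s => ‖s - t‖ₑ *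
      (eLpNorm (fun x => (A s x - A t x) / (s - t) - A' x) ⊤ + eLpNorm A' ⊤)) (𝓝[≠] t) (𝓝 0) := by
    have hsum := (hA.tendsto ⊤ (Or.inr rfl)).add_const (eLpNorm A' ⊤ volume)
    rw [zero_add] at hsum
    have := ENNReal.Tendsto.mul hst (Or.inr hA.deriv_memLp_top.2.ne) hsum
      (Or.inr ENNReal.zero_ne_top)
    simpa using this
  refine tendsto_of_tendsto_of_tendsto_of_le_of_le' tendsto_const_nhds hlim
    (.of_forall fun _ => zero_le) ?_
  filter_upwards [self_mem_nhdsWithin] with s hs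
  have hs' : s - t ≠ 0 := sub_ne_zero.2 hs
  have e : (fun x => A s x - A t x)
      = (s - t) • ((fun x => (A s x - A t x) / (s - t) - A' x) + A') := by
    ext x
    simp only [Pi.smul_apply, Pi.add_apply, smul_eq_mul]
    rw [sub_add_cancel, mul_div_cancel₀ _ hs']
  rw [e]
  exact eLpNorm_const_smul_le.trans (mul_le_mul' le_rfl
    (eLpNorm_add_le (hA.aestronglyMeasurable s) hA.deriv_memLp_top.1 le_top))

/-- Working in `L¹` and `L^∞` at once closes the class under products: in each term of the remainder
one factor is measured in `L^p`, the other in `L^∞`. -/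
theorem mul (hA : HasLpDerivAt A A' t) (hB : HasLpDerivAt B B' t) :
    HasLpDerivAt (fun s x => A s x * B s x) (fun x => A' x * B t x + A t x * B' x) t where
  memLp_top s := (hB.memLp_top s).mul' (hA.memLp_top s)
  deriv_memLp_top := ((hB.memLp_top t).mul' hA.deriv_memLp_top).add
    (hB.deriv_memLp_top.mul' (hA.memLp_top t))
  deriv_integrable := by
    refine Integrable.add ?_ ((hA.memLp_top t).integrable_mul_of_top hB.deriv_integrable)
    simpa only [mul_comm] using (hB.memLp_top t).integrable_mul_of_top hA.deriv_integrable
  tendsto p hp := by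
    have hp1 : 1 ≤ p := by rcases hp with rfl | rfl <;> simp
    set δA := fun s x => (A s x - A t x) / (s - t) - A' x with hδA
    set δB := fun s x => (B s x - B t x) / (s - t) - B' x with hδB
    set ΔB := fun s x => B s x - B t x with hΔB
    have mΔ : ∀ s, AEStronglyMeasurable (ΔB s) := fun s => (hB.memLp_top s).1.sub (hB.memLp_top t).1
    have mA : ∀ s, AEStronglyMeasurable (δA s) := hA.aestronglyMeasurable
    have mB : ∀ s, AEStronglyMeasurable (δB s) := hB.aestronglyMeasurable
    have tA : Tendsto (fun s => eLpNorm (δA s) p) (𝓝[≠] t) (𝓝 0) := hA.tendsto p hp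
    have tB : Tendsto (fun s => eLpNorm (δB s) p) (𝓝[≠] t) (𝓝 0) := hB.tendsto p hp
    have tΔ : Tendsto (fun s => eLpNorm (ΔB s) ⊤) (𝓝[≠] t) (𝓝 0) := hB.tendsto_sub
    have lim : Tendsto (fun s => eLpNorm (δA s) p * eLpNorm (ΔB s) ⊤
        + eLpNorm (δA s) p * eLpNorm (B t) ⊤ + eLpNorm A' p * eLpNorm (ΔB s) ⊤
        + eLpNorm (A t) ⊤ * eLpNorm (δB s) p) (𝓝[≠] t) (𝓝 0) := by
      have l1 := ENNReal.Tendsto.mul tA (Or.inr ENNReal.zero_ne_top) tΔ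
        (Or.inr ENNReal.zero_ne_top)
      have l2 := ENNReal.Tendsto.mul_const tA (Or.inr (hB.memLp_top t).2.ne)
      have l3 := ENNReal.Tendsto.const_mul tΔ (Or.inr (hA.deriv_memLp hp).2.ne)
      have l4 := ENNReal.Tendsto.const_mul tB (Or.inr (hA.memLp_top t).2.ne)
      simpa using ((l1.add l2).add l3).add l4
    refine tendsto_of_tendsto_of_tendsto_of_le_of_le tendsto_const_nhds lim
      (fun _ => zero_le) fun s => ?_
    have e : (fun x => (A s x * B s x - A t x * B t x) / (s - t)
        - (A' x * B t x + A t x * B' x))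
        = δA s • ΔB s + δA s • B t + A' • ΔB s + A t • δB s := by
      ext x
      simp only [Pi.add_apply, Pi.mul_apply, smul_eq_mul, hδA, hδB, hΔB]
      ring
    change eLpNorm (fun x => (A s x * B s x - A t x * B t x) / (s - t)
        - (A' x * B t x + A t x * B' x)) p _ ≤ _
    rw [e]
    have m1 := (mA s).smul (mΔ s)
    have m2 := (mA s).smul (hB.memLp_top t).1
    have m3 := hA.deriv_memLp_top.1.smul (mΔ s)
    have m4 := (hA.memLp_top t).1.smul (mB s)
    refine (eLpNorm_add_le ((m1.add m2).add m3) m4 hp1).trans ?_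
    refine add_le_add ((eLpNorm_add_le (m1.add m2) m3 hp1).trans
      (add_le_add ((eLpNorm_add_le m1 m2 hp1).trans (add_le_add ?_ ?_)) ?_)) ?_
    · exact eLpNorm_smul_le_eLpNorm_mul_eLpNorm_top p _ (mA s)
    · exact eLpNorm_smul_le_eLpNorm_mul_eLpNorm_top p _ (mA s)
    · exact eLpNorm_smul_le_eLpNorm_mul_eLpNorm_top p _ hA.deriv_memLp_top.1
    · exact eLpNorm_smul_le_eLpNorm_top_mul_eLpNorm p (mB s) _

theorem hasDerivAt_integral (hA : HasLpDerivAt A A' t) (hi : ∀ s, Integrable (A s)) :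
    HasDerivAt (fun s => ∫ x, A s x) (∫ x, A' x) t := by
  rw [hasDerivAt_iff_tendsto_slope, ← tendsto_sub_nhds_zero_iff,
    tendsto_zero_iff_enorm_tendsto_zero]
  refine tendsto_of_tendsto_of_tendsto_of_le_of_le tendsto_const_nhds
    (hA.tendsto 1 (Or.inl rfl)) (fun _ => zero_le) fun s => ?_
  have : slope (fun s => ∫ x, A s x) t s - ∫ x, A' x
      = ∫ x, ((A s x - A t x) / (s - t) - A' x) := by
    have hd : Integrable fun x => A s x - A t x := (hi s).sub (hi t)
    rw [integral_sub (hd.div_const _) hA.deriv_integrable, integral_div,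
      integral_sub (hi s) (hi t), slope_def_field]
  change ‖slope (fun s => ∫ x, A s x) t s - ∫ x, A' x‖ₑ ≤ _
  rw [this, eLpNorm_one_eq_lintegral_enorm]
  exact enorm_integral_le_lintegral_enorm _

end HasLpDerivAt

theorem eLpNorm_one_eq_ofReal_integral {g : ℝ → ℝ} (hg : Integrable g) :
    eLpNorm g 1 = ENNReal.ofReal (∫ x, |g x|) := by
  rw [eLpNorm_one_eq_lintegral_enorm, ← ofReal_integral_norm_eq_lintegral_enorm hg]
  rfl

theorem eLpNorm_top_le_ofReal_integral_deriv {g : ℝ → ℝ} (hg : g ∈ phaseSpace) :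
    eLpNorm g ⊤ ≤ ENNReal.ofReal (∫ x, |deriv g x|) := by
  rw [eLpNorm_exponent_top]
  exact eLpNormEssSup_le_of_ae_bound (.of_forall (norm_le_integral_deriv hg))

/-! ### Curves in the phase space and the chain rule -/

/-- `t ↦ u t` is a curve in the phase space with velocity `w` at time `t`. -/
structure HasPhaseSpaceDerivAt (u : ℝ → ℝ → ℝ) (w : ℝ → ℝ) (t : ℝ) : Prop where
  mem : ∀ s, u s ∈ phaseSpace
  deriv_mem : w ∈ phaseSpace
  tendsto : ∀ n : ℕ, Tendsto
    (fun s => ∫ x, |iteratedDeriv n (fun y => (u s y - u t y) / (s - t) - w y) x|) (𝓝[≠] t) (𝓝 0)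

namespace HasPhaseSpaceDerivAt

variable {u : ℝ → ℝ → ℝ} {w : ℝ → ℝ} {t : ℝ}

theorem quotient_mem (hu : HasPhaseSpaceDerivAt u w t) (s : ℝ) :
    (fun y => (u s y - u t y) / (s - t) - w y) ∈ phaseSpace := by
  have := phaseSpace.sub_mem (phaseSpace.smul_mem (s - t)⁻¹
    (phaseSpace.sub_mem (hu.mem s) (hu.mem t))) hu.deriv_mem
  convert this using 1
  ext y
  simp [div_eq_inv_mul]

theorem iteratedDeriv_quotient (hu : HasPhaseSpaceDerivAt u w t) (n : ℕ) (s x : ℝ) :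
    iteratedDeriv n (fun y => (u s y - u t y) / (s - t) - w y) x
      = (iteratedDeriv n (u s) x - iteratedDeriv n (u t) x) / (s - t) - iteratedDeriv n w x := by
  have c : ∀ {g : ℝ → ℝ}, g ∈ phaseSpace → ContDiffAt ℝ n g x := fun hg =>
    (hg.1.of_le (by exact_mod_cast le_top)).contDiffAt
  have e : (fun y => (u s y - u t y) / (s - t) - w y) = (s - t)⁻¹ • (u s - u t) - w := by
    ext y
    simp [div_eq_inv_mul]
  have m := phaseSpace.sub_mem (hu.mem s) (hu.mem t)
  rw [e, iteratedDeriv_sub (c (phaseSpace.smul_mem _ m)) (c hu.deriv_mem),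
    iteratedDeriv_const_smul_field, iteratedDeriv_sub (c (hu.mem s)) (c (hu.mem t))]
  simp [div_eq_inv_mul]

theorem hasLpDerivAt_iteratedDeriv (hu : HasPhaseSpaceDerivAt u w t) (n : ℕ) :
    HasLpDerivAt (fun s => iteratedDeriv n (u s)) (iteratedDeriv n w) t where
  memLp_top s := memLp_top_of_mem_phaseSpace (iteratedDeriv_mem_phaseSpace (hu.mem s) n)
  deriv_memLp_top := memLp_top_of_mem_phaseSpace (iteratedDeriv_mem_phaseSpace hu.deriv_mem n)
  deriv_integrable := hu.deriv_mem.2 n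
  tendsto p hp := by
    simp only [← hu.iteratedDeriv_quotient]
    rcases hp with rfl | rfl
    · have := ENNReal.tendsto_ofReal (hu.tendsto n)
      rw [ENNReal.ofReal_zero] at this
      refine this.congr fun s => ?_
      exact (eLpNorm_one_eq_ofReal_integral ((hu.quotient_mem s).2 n)).symm
    -- The sup norm of the `n`-th derivative is bounded by the seminorm of order `n + 1`.
    · have := ENNReal.tendsto_ofReal (hu.tendsto (n + 1))
      rw [ENNReal.ofReal_zero] at this
      refine tendsto_of_tendsto_of_tendsto_of_le_of_le tendsto_const_nhds this
        (fun _ => zero_le) fun s => ?_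
      have := eLpNorm_top_le_ofReal_integral_deriv
        (iteratedDeriv_mem_phaseSpace (hu.quotient_mem s) n)
      rwa [← iteratedDeriv_succ] at this

open MvPolynomial in
-- The index set `s` is kept apart from `f.vars` so that it stays fixed while the induction runs
-- through subexpressions of `f`.
theorem hasLpDerivAt_evalJet (hu : HasPhaseSpaceDerivAt u w t) (s : Finset ℕ)
    {f : MvPolynomial ℕ ℝ} (hf : f ∈ supported ℝ (s : Set ℕ)) :
    HasLpDerivAt (fun σ => evalJet f (u σ))
      (fun x => ∑ n ∈ s, evalJet (pderiv n f) (u t) x * iteratedDeriv n w x) t := by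
  induction hf using Algebra.adjoin_induction with
  | mem p hp =>
    obtain ⟨i, hi, rfl⟩ := hp
    have e : ∀ n, pderiv n (X i : MvPolynomial ℕ ℝ) = if n = i then 1 else 0 := fun n => by
      rw [pderiv_X, Pi.single_apply]
      simp only [eq_comm]
    convert hu.hasLpDerivAt_iteratedDeriv i using 1
    · simp
    · ext x
      rw [Finset.sum_eq_single i]
      · simp [e, evalJet]
      · intro n _ hn
        simp [e, hn, evalJet]
      · intro h
        exact absurd hi h
  | algebraMap r =>
    convert HasLpDerivAt.const r t using 1
    · simp [algebraMap_eq]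
    · simp [algebraMap_eq]
  | add p q _ _ hp hq =>
    convert hp.add hq using 1
    · simp
    · ext x
      simp [add_mul, Finset.sum_add_distrib]
  | mul p q _ _ hp hq =>
    convert hp.mul hq using 1
    · simp
    · ext x
      rw [Finset.sum_mul, Finset.mul_sum, ← Finset.sum_add_distrib]
      refine Finset.sum_congr rfl fun n _ => ?_
      simp only [Derivation.leibniz, smul_eq_mul, evalJet_add, evalJet_mul]
      ring

/-- The chain rule for local functionals along differentiable curves in the phase space. -/
theorem hasDerivAt_functional (hu : HasPhaseSpaceDerivAt u w t) {f : MvPolynomial ℕ ℝ}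
    (hf : MvPolynomial.constantCoeff f = 0) :
    HasDerivAt (fun s => functional f (u s)) (∫ x, variationalDeriv f (u t) x * w x) t := by
  rw [← integral_sum_pderiv_mul_iteratedDeriv (hu.mem t) hu.deriv_mem]
  exact (hu.hasLpDerivAt_evalJet f.vars f.mem_supported_vars).hasDerivAt_integral
    fun s => integrable_evalJet (hu.mem s) hf

theorem line {g v : ℝ → ℝ} (hg : g ∈ phaseSpace) (hv : v ∈ phaseSpace) (t : ℝ) :
    HasPhaseSpaceDerivAt (fun s => g + s • v) v t where
  mem s := phaseSpace.add_mem hg (phaseSpace.smul_mem s hv)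
  deriv_mem := hv
  tendsto n := by
    refine tendsto_const_nhds.congr' ?_
    filter_upwards [self_mem_nhdsWithin] with s hs
    have hs' : s - t ≠ 0 := sub_ne_zero.2 hs
    have : (fun y => ((g + s • v) y - (g + t • v) y) / (s - t) - v y) = fun _ => 0 := by
      ext y
      simp
      field_simp
      ring
    rw [this]
    simp

/-- A differentiable curve in the phase space is differentiable pointwise. -/
theorem hasDerivAt_apply (hu : HasPhaseSpaceDerivAt u w t) (x : ℝ) :
    HasDerivAt (fun s => u s x) (w x) t := by
  rw [hasDerivAt_iff_tendsto_slope, ← tendsto_sub_nhds_zero_iff]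
  refine squeeze_zero_norm (fun s => ?_) (hu.tendsto 1)
  rw [slope_def_field]
  simpa using norm_le_integral_deriv (hu.quotient_mem s) x

end HasPhaseSpaceDerivAt

/-! ### The Lenard recursion and involution -/

/-- `h 0, h 1, …` satisfy the Lenard recursion `∂ₓ h_{j+1} = (a u ∂ₓ + a ∂ₓ u + b ∂ₓ³) h_j`,
starting from `h 0 = u`. -/
structure IsLenardSequence (a b : ℝ) (h : ℕ → MvPolynomial ℕ ℝ) : Prop where
  zero : h 0 = MvPolynomial.X 0
  constantCoeff : ∀ j, MvPolynomial.constantCoeff (h j) = 0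
  succ : ∀ j, totalDeriv (h (j + 1))
    = 2 * MvPolynomial.C a * MvPolynomial.X 0 * totalDeriv (h j)
      + MvPolynomial.C a * MvPolynomial.X 1 * h j
      + MvPolynomial.C b * totalDeriv (totalDeriv (totalDeriv (h j)))

section Lenard

variable {a b : ℝ} {h f : ℕ → MvPolynomial ℕ ℝ} {g : ℝ → ℝ}

theorem totalDeriv_C (r : ℝ) : totalDeriv (MvPolynomial.C r) = 0 := by
  simp [totalDeriv]

/-- Write `P` for the operator of the recursion. Modulo total derivatives, skew-adjointness of `P`
and `D` gives `h_j D h_{k+1} = h_j P h_k ≡ -(P h_j) h_k = -(D h_{j+1}) h_k ≡ h_{j+1} D h_k`.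
Iterating moves the whole index `k` to the left factor. -/
theorem IsLenardSequence.exists_mul_sub (hh : IsLenardSequence a b h) (j k : ℕ) :
    h j * totalDeriv (h k) - h (j + k) * totalDeriv (h 0) ∈
      LinearMap.range (totalDeriv : MvPolynomial ℕ ℝ →ₗ[ℝ] MvPolynomial ℕ ℝ) := by
  induction k generalizing j with
  | zero => simp
  | succ k ih =>
    have step : h j * totalDeriv (h (k + 1)) - h (j + 1) * totalDeriv (h k) ∈
        LinearMap.range (totalDeriv : MvPolynomial ℕ ℝ →ₗ[ℝ] MvPolynomial ℕ ℝ) := by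
      refine ⟨MvPolynomial.C a * (2 * MvPolynomial.X 0 * h j * h k)
        + MvPolynomial.C b * (h j * totalDeriv (totalDeriv (h k))
          + h k * totalDeriv (totalDeriv (h j)) - totalDeriv (h j) * totalDeriv (h k))
        - h (j + 1) * h k, ?_⟩
      have h2 : totalDeriv 2 = 0 := by simpa using totalDeriv.map_natCast 2
      simp only [Derivation.coeFn_coe, map_add, map_sub, Derivation.leibniz, smul_eq_mul,
        totalDeriv_C, hh.succ, totalDeriv_X, h2]
      ring
    have := add_mem step (ih (j + 1))
    rwa [sub_add_sub_cancel, show j + 1 + k = j + (k + 1) by ring] at this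

/-- Modulo total derivatives, `h_j D h_k` and `h_k D h_j` both equal `h_{j+k} D h_0`, while their
sum is `D (h_j h_k)`; hence twice either one is a total derivative. -/
theorem IsLenardSequence.exists_mul_totalDeriv (hh : IsLenardSequence a b h) (j k : ℕ) :
    ∃ r, h j * totalDeriv (h k) = totalDeriv r := by
  have e1 := hh.exists_mul_sub j k
  have e2 := hh.exists_mul_sub k j
  rw [add_comm k j] at e2
  obtain ⟨r, hr⟩ := sub_mem e1 e2
  rw [sub_sub_sub_cancel_right] at hr
  simp only [Derivation.coeFn_coe] at hr
  refine ⟨(1 / 2 : ℝ) • (r + h j * h k), ?_⟩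
  rw [Derivation.map_smul, map_add, hr, Derivation.leibniz, smul_eq_mul, smul_eq_mul,
    sub_add_add_cancel, ← two_smul ℝ, smul_smul]
  norm_num

theorem IsLenardSequence.integral_mul_totalDeriv (hh : IsLenardSequence a b h)
    (hg : g ∈ phaseSpace) (j k : ℕ) :
    ∫ x, evalJet (h j) g x * evalJet (totalDeriv (h k)) g x = 0 := by
  obtain ⟨r, hr⟩ := hh.exists_mul_totalDeriv j k
  simpa [← hr] using integral_evalJet_totalDeriv hg r

theorem antideriv_evalJet_totalDeriv (hg : g ∈ phaseSpace) {p : MvPolynomial ℕ ℝ}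
    (hp : MvPolynomial.constantCoeff p = 0) :
    antideriv (evalJet (totalDeriv p) g) = evalJet p g := by
  rw [← deriv_evalJet hg, antideriv_deriv (evalJet_mem_phaseSpace hg hp)]

/-- The nonlocal `𝒟⁻¹` only ever meets the derivative of `h j`, which it undoes exactly because `h
j` vanishes at `-∞`. -/
theorem IsLenardSequence.kdvField_eq (hh : IsLenardSequence a b h) (hg : g ∈ phaseSpace) (j : ℕ) :
    kdvField a b (j + 1) g = evalJet (totalDeriv (h j)) g := by
  induction j with
  | zero => simp [kdvField, hh.zero]
  | succ j ih =>
    ext x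
    have e : (fun y => g y * evalJet (h j) g y) = evalJet (MvPolynomial.X 0 * h j) g := by simp
    rw [kdvField, ih, antideriv_evalJet_totalDeriv hg (hh.constantCoeff j), e, deriv_evalJet hg,
      iteratedDeriv_evalJet hg, hh.succ]
    simp [evalJet]
    ring

theorem IsLenardSequence.kdvField_mem (hh : IsLenardSequence a b h) (hg : g ∈ phaseSpace) (j : ℕ) :
    kdvField a b (j + 1) g ∈ phaseSpace := by
  rw [hh.kdvField_eq hg]
  exact evalJet_mem_phaseSpace hg (constantCoeff_totalDeriv _)

theorem exists_isLenardSequence (a b : ℝ) : ∃ h, IsLenardSequence a b h ∧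
    ∃ f, IsKdVDensities a b f := by
  obtain ⟨h, f, h0, f0, hc, fc, hs, hf⟩ := exists_hierarchy a b
  have hh : IsLenardSequence a b h := ⟨h0, hc, hs⟩
  -- Densities are numbered from `1`, power series coefficients from `0`; the value at index `0` is
  -- irrelevant.
  refine ⟨h, hh, fun j => f (j - 1), f0, fun j _ => fc _, fun j hj g hg => ?_⟩
  obtain ⟨j, rfl⟩ := Nat.exists_eq_add_of_le' hj
  rw [hh.kdvField_eq hg, antideriv_evalJet_totalDeriv hg (hc j)]
  exact variationalDeriv_eq_of_evolutionaryDeriv (fun Q => hf Q j) hg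

/-- Arbitrary admissible densities are handled through their gradients, which the fields determine;
they need not be the densities constructed from `k`. -/
theorem IsKdVDensities.variationalDeriv_eq_evalJet (hf : IsKdVDensities a b f)
    (hh : IsLenardSequence a b h) (hg : g ∈ phaseSpace) (j : ℕ) :
    variationalDeriv (f (j + 1)) g = evalJet (h j) g := by
  rw [hf.variationalDeriv_eq _ (Nat.le_add_left 1 j) g hg, hh.kdvField_eq hg,
    antideriv_evalJet_totalDeriv hg (hh.constantCoeff j)]

theorem isHamiltonianVectorAt_functional (hg : g ∈ phaseSpace) {p q : MvPolynomial ℕ ℝ}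
    (hp : MvPolynomial.constantCoeff p = 0) (hq : MvPolynomial.constantCoeff q = 0)
    (h : variationalDeriv p g = evalJet q g) :
    IsHamiltonianVectorAt (functional p) g (evalJet (totalDeriv q) g) := by
  refine ⟨evalJet_mem_phaseSpace hg (constantCoeff_totalDeriv _), fun v hv => ?_⟩
  rw [← deriv_evalJet hg, symplecticForm_deriv_left (evalJet_mem_phaseSpace hg hq) hv, ← h]
  simpa using (HasPhaseSpaceDerivAt.line hg hv 0).hasDerivAt_functional hp

theorem IsKdVDensities.isHamiltonianVectorAt (hf : IsKdVDensities a b f)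
    (hh : IsLenardSequence a b h) (hg : g ∈ phaseSpace) (j : ℕ) :
    IsHamiltonianVectorAt (functional (f (j + 1))) g (kdvField a b (j + 1) g) := by
  rw [hh.kdvField_eq hg]
  exact isHamiltonianVectorAt_functional hg (hf.constantCoeff _ (Nat.le_add_left 1 j))
    (hh.constantCoeff j) (hf.variationalDeriv_eq_evalJet hh hg j)

theorem IsLenardSequence.symplecticForm_kdvField (hh : IsLenardSequence a b h)
    (hg : g ∈ phaseSpace) (j k : ℕ) :
    symplecticForm (kdvField a b (j + 1) g) (kdvField a b (k + 1) g) = 0 := by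
  rw [hh.kdvField_eq hg, hh.kdvField_eq hg, ← deriv_evalJet hg (h j),
    symplecticForm_deriv_left (evalJet_mem_phaseSpace hg (hh.constantCoeff j))
      (evalJet_mem_phaseSpace hg (constantCoeff_totalDeriv _)), hh.integral_mul_totalDeriv hg]

theorem functional_zero {p : MvPolynomial ℕ ℝ} (hp : MvPolynomial.constantCoeff p = 0) :
    functional p 0 = 0 := by
  have e : evalJet p 0 = 0 := by
    ext x
    have hx : (fun n => iteratedDeriv n (0 : ℝ → ℝ) x) = 0 := by
      ext n
      simp
    rw [evalJet, hx, Pi.zero_apply, MvPolynomial.eval_zero, hp]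
  simp [functional, e]

/-- A local functional is determined by the variational derivative of its density. -/
theorem functional_eq_of_variationalDeriv_eq {p q : MvPolynomial ℕ ℝ}
    (hp : MvPolynomial.constantCoeff p = 0) (hq : MvPolynomial.constantCoeff q = 0)
    (h : ∀ g ∈ phaseSpace, variationalDeriv p g = variationalDeriv q g) (hg : g ∈ phaseSpace) :
    functional p g = functional q g := by
  -- The difference is constant along the ray `s ↦ s • g`, and both functionals vanish at `0`.
  have hd : ∀ s : ℝ, HasDerivAt
      (fun s : ℝ => functional p (0 + s • g) - functional q (0 + s • g)) 0 s := fun s => by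
    have l := HasPhaseSpaceDerivAt.line phaseSpace.zero_mem hg s
    have := (l.hasDerivAt_functional hp).sub (l.hasDerivAt_functional hq)
    rwa [h _ (l.mem s), sub_self] at this
  have := is_const_of_deriv_eq_zero (fun s => (hd s).differentiableAt) (fun s => (hd s).deriv) 1 0
  simpa [functional_zero hp, functional_zero hq, sub_eq_zero] using this

end Lenard

/-! ### The standard KdV equation -/

section KdV

open MvPolynomial

variable {h f : ℕ → MvPolynomial ℕ ℝ} {g : ℝ → ℝ}

/-- The density `u³ + ½ u_x²` of the Hamiltonian of the standard KdV equation. -/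
noncomputable def kdvDensity : MvPolynomial ℕ ℝ := X 0 ^ 3 + C (1 / 2) * X 1 ^ 2

/-- The variational derivative `3 u² - u_xx` of `kdvDensity`. -/
noncomputable def kdvGradient : MvPolynomial ℕ ℝ := 3 * X 0 ^ 2 - X 2

theorem constantCoeff_kdvDensity : constantCoeff kdvDensity = 0 := by
  simp [kdvDensity]

theorem constantCoeff_kdvGradient : constantCoeff kdvGradient = 0 := by
  simp [kdvGradient]

theorem kdvHamiltonian_eq : kdvHamiltonian = functional kdvDensity := by
  ext g
  simp [kdvHamiltonian, functional, kdvDensity, evalJet]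

theorem variationalDeriv_kdvDensity (hg : g ∈ phaseSpace) :
    variationalDeriv kdvDensity g = evalJet kdvGradient g := by
  -- `X 1 * Q` is the boundary term from integrating `u_x 𝒟Q`, the variation of `½ u_x²`, by parts.
  refine variationalDeriv_eq_of_evolutionaryDeriv (fun Q => ⟨X 1 * Q, ?_⟩) hg
  have h2 : (C (1 / 2) : MvPolynomial ℕ ℝ) * 2 = 1 := by
    rw [← map_ofNat (C (σ := ℕ) (R := ℝ)) 2, ← map_mul]
    norm_num
  have hC : evolutionaryDeriv Q (C (1 / 2)) = 0 := by simp [evolutionaryDeriv]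
  simp only [kdvDensity, kdvGradient, map_add, Derivation.leibniz, Derivation.leibniz_pow, hC,
    evolutionaryDeriv_X, smul_eq_mul, nsmul_eq_mul, totalDeriv_X, Function.iterate_zero_apply,
    Function.iterate_one]
  push_cast
  linear_combination X 1 * totalDeriv Q * h2

theorem totalDeriv_kdvGradient : totalDeriv kdvGradient = 6 * X 0 * X 1 - X 3 := by
  have h3 : totalDeriv 3 = 0 := by simpa using totalDeriv.map_natCast 3
  simp only [kdvGradient, map_sub, Derivation.leibniz, Derivation.leibniz_pow, h3, totalDeriv_X,
    smul_eq_mul, nsmul_eq_mul]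
  push_cast
  ring

theorem IsLenardSequence.totalDeriv_one (hh : IsLenardSequence 2 (-1) h) :
    totalDeriv (h 1) = totalDeriv kdvGradient := by
  have h2 : (C 2 : MvPolynomial ℕ ℝ) = 2 := map_ofNat _ 2
  rw [hh.succ, hh.zero, totalDeriv_kdvGradient, h2]
  simp only [totalDeriv_X, map_neg, map_one]
  ring

theorem IsLenardSequence.kdvField_two (hh : IsLenardSequence 2 (-1) h) (hg : g ∈ phaseSpace) :
    kdvField 2 (-1) 2 g = evalJet (totalDeriv kdvGradient) g := by
  rw [hh.kdvField_eq hg 1, hh.totalDeriv_one]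

theorem IsLenardSequence.kdvField_two_apply (hh : IsLenardSequence 2 (-1) h)
    (hg : g ∈ phaseSpace) (x : ℝ) :
    kdvField 2 (-1) 2 g x = 6 * g x * deriv g x - iteratedDeriv 3 g x := by
  rw [hh.kdvField_two hg, totalDeriv_kdvGradient]
  simp [evalJet]

theorem isSolution_iff_isKdVSolution {u : ℝ → ℝ → ℝ} (hu : ∀ t, u t ∈ phaseSpace) :
    IsSolution (kdvField 2 (-1) 2) u ↔ IsKdVSolution u := by
  obtain ⟨h, hh, -⟩ := exists_isLenardSequence 2 (-1)
  refine forall_congr' fun t => forall_congr' fun x => ?_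
  rw [hh.kdvField_two_apply (hu t)]
  constructor
  · intro H
    refine ⟨H.differentiableAt, ?_⟩
    rw [H.deriv]
    ring
  · rintro ⟨H, e⟩
    exact H.hasDerivAt.congr_deriv (by linear_combination e)

/-- The density `f 2` is not unique, so the functionals are compared through their gradients. -/
theorem IsKdVDensities.kdvHamiltonian_eq_functional (hf : IsKdVDensities 2 (-1) f)
    (hg : g ∈ phaseSpace) : kdvHamiltonian g = functional (f 2) g := by
  obtain ⟨h, hh, -⟩ := exists_isLenardSequence 2 (-1)
  rw [kdvHamiltonian_eq]
  refine functional_eq_of_variationalDeriv_eq constantCoeff_kdvDensity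
    (hf.constantCoeff 2 one_le_two) (fun g hg => ?_) hg
  rw [variationalDeriv_kdvDensity hg, hf.variationalDeriv_eq 2 one_le_two g hg,
    hh.kdvField_two hg, antideriv_evalJet_totalDeriv hg constantCoeff_kdvGradient]

theorem IsLenardSequence.hamiltonianVectorField_kdvHamiltonian (hh : IsLenardSequence 2 (-1) h)
    (hg : g ∈ phaseSpace) : hamiltonianVectorField kdvHamiltonian g = kdvField 2 (-1) 2 g := by
  rw [hh.kdvField_two hg, kdvHamiltonian_eq]
  exact hamiltonianVectorField_eq (isHamiltonianVectorAt_functional hg constantCoeff_kdvDensity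
    constantCoeff_kdvGradient (variationalDeriv_kdvDensity hg))

theorem IsKdVDensities.functional_conserved (hf : IsKdVDensities 2 (-1) f) (k : ℕ)
    {u : ℝ → ℝ → ℝ} (hu : IsDifferentiableCurve u) (hsol : IsKdVSolution u) (s t : ℝ) :
    functional (f (k + 1)) (u s) = functional (f (k + 1)) (u t) := by
  obtain ⟨h, hh, -⟩ := exists_isLenardSequence 2 (-1)
  obtain ⟨mem, w, hw, lim⟩ := hu
  have hd : ∀ t, HasDerivAt (fun s => functional (f (k + 1)) (u s)) 0 t := fun t => by
    have H : HasPhaseSpaceDerivAt u (w t) t := ⟨mem, hw t, lim t⟩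
    -- Convergence in the phase space implies pointwise convergence, so the velocity of the curve is
    -- the right side of the equation. The derivative of the functional is then `∫ h_k 𝒟h_1 = 0`.
    have e : w t = evalJet (totalDeriv (h 1)) (u t) := by
      rw [← hh.kdvField_eq (mem t)]
      ext x
      exact (H.hasDerivAt_apply x).unique ((isSolution_iff_isKdVSolution mem).2 hsol t x)
    have := H.hasDerivAt_functional (hf.constantCoeff (k + 1) (Nat.le_add_left 1 k))
    rwa [hf.variationalDeriv_eq_evalJet hh (mem t), e, hh.integral_mul_totalDeriv (mem t)] at this
  exact is_const_of_deriv_eq_zero (fun s => (hd s).differentiableAt) (fun s => (hd s).deriv) s t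

end KdV

theorem mainTheorem2 :
    -- the hierarchy is well defined: the `X_j` map the phase space to itself, densities exist
    (∀ a b : ℝ, (∀ j, 1 ≤ j → ∀ g ∈ phaseSpace, kdvField a b j g ∈ phaseSpace) ∧
      ∃ f : ℕ → MvPolynomial ℕ ℝ, IsKdVDensities a b f) ∧
    -- `X_j = (a g 𝒟 + a 𝒟 g + b 𝒟³) δf_{j-1}/δg` and `X_j = ∂ₓ (δf_j/δg)`
    (∀ (a b : ℝ) (f : ℕ → MvPolynomial ℕ ℝ), IsKdVDensities a b f → ∀ g ∈ phaseSpace,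
      (∀ j, 2 ≤ j → ∀ x, kdvField a b j g x =
        a * g x * deriv (variationalDeriv (f (j - 1)) g) x
          + a * deriv (fun y => g y * variationalDeriv (f (j - 1)) g y) x
          + b * iteratedDeriv 3 (variationalDeriv (f (j - 1)) g) x) ∧
      ∀ j, 1 ≤ j → kdvField a b j g = deriv (variationalDeriv (f j) g)) ∧
    -- 1) the case `a = 2`, `b = -1`, `j = 2` is the standard KdV equation
    ((∀ g ∈ phaseSpace, ∀ x,
        kdvField 2 (-1) 2 g x = 6 * g x * deriv g x - iteratedDeriv 3 g x) ∧
      ∀ u : ℝ → ℝ → ℝ, (∀ t, u t ∈ phaseSpace) →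
        (IsSolution (kdvField 2 (-1) 2) u ↔ IsKdVSolution u)) ∧
    -- 2) `X_j` is the Hamiltonian vector field of `F_j = ∫ f_j dx`
    (∀ (a b : ℝ) (f : ℕ → MvPolynomial ℕ ℝ), IsKdVDensities a b f →
      ∀ j, 1 ≤ j → ∀ g ∈ phaseSpace,
        Integrable (evalJet (f j) g) ∧
        IsHamiltonianVectorAt (functional (f j)) g (kdvField a b j g) ∧
        hamiltonianVectorField (functional (f j)) g = kdvField a b j g) ∧
    -- 3) all `F_j` Poisson-commute
    (∀ (a b : ℝ) (f : ℕ → MvPolynomial ℕ ℝ), IsKdVDensities a b f →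
      ∀ j k, 1 ≤ j → 1 ≤ k → ∀ g ∈ phaseSpace,
        poissonBracket (functional (f j)) (functional (f k)) g = 0) ∧
    -- 4) `H = F_2`, and all `F_k` are integrals of the standard KdV equation
    (∀ f : ℕ → MvPolynomial ℕ ℝ, IsKdVDensities 2 (-1) f →
      (∀ g ∈ phaseSpace, kdvHamiltonian g = functional (f 2) g) ∧
      ∀ k, 1 ≤ k →
        (∀ g ∈ phaseSpace, poissonBracket kdvHamiltonian (functional (f k)) g = 0) ∧
        ∀ u : ℝ → ℝ → ℝ, IsDifferentiableCurve u → IsKdVSolution u →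
          ∀ s t, functional (f k) (u s) = functional (f k) (u t)) := by
  refine ⟨fun a b => ?_, fun a b f hf g hg => ?_, ⟨fun g hg x => ?_, fun u hu =>
    isSolution_iff_isKdVSolution hu⟩, fun a b f hf j hj g hg => ?_,
    fun a b f hf j k hj hk g hg => ?_, fun f hf => ⟨fun g hg =>
      hf.kdvHamiltonian_eq_functional hg, fun k hk => ⟨fun g hg => ?_, fun u hu hsol s t => ?_⟩⟩⟩
  · obtain ⟨h, hh, hf⟩ := exists_isLenardSequence a b
    refine ⟨fun j hj g hg => ?_, hf⟩
    obtain ⟨j, rfl⟩ := Nat.exists_eq_add_of_le' hj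
    exact hh.kdvField_mem hg j
  · obtain ⟨h, hh, -⟩ := exists_isLenardSequence a b
    constructor
    · intro j hj x
      obtain ⟨j, rfl⟩ := Nat.exists_eq_add_of_le' hj
      have e : (fun y => g y * evalJet (h j) g y) = evalJet (MvPolynomial.X 0 * h j) g := by simp
      rw [show j + 2 - 1 = j + 1 by omega, hf.variationalDeriv_eq_evalJet hh hg j, e,
        deriv_evalJet hg, deriv_evalJet hg, iteratedDeriv_evalJet hg, hh.kdvField_eq hg (j + 1),
        hh.succ]
      simp [evalJet]
      ring
    · intro j hj
      obtain ⟨j, rfl⟩ := Nat.exists_eq_add_of_le' hj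
      rw [hf.variationalDeriv_eq_evalJet hh hg j, deriv_evalJet hg, hh.kdvField_eq hg]
  · obtain ⟨h, hh, -⟩ := exists_isLenardSequence 2 (-1)
    exact hh.kdvField_two_apply hg x
  · obtain ⟨h, hh, -⟩ := exists_isLenardSequence a b
    obtain ⟨j, rfl⟩ := Nat.exists_eq_add_of_le' hj
    have H := hf.isHamiltonianVectorAt hh hg j
    exact ⟨integrable_evalJet hg (hf.constantCoeff _ hj), H, hamiltonianVectorField_eq H⟩
  · obtain ⟨h, hh, -⟩ := exists_isLenardSequence a b
    obtain ⟨j, rfl⟩ := Nat.exists_eq_add_of_le' hj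
    obtain ⟨k, rfl⟩ := Nat.exists_eq_add_of_le' hk
    rw [poissonBracket, hamiltonianVectorField_eq (hf.isHamiltonianVectorAt hh hg j),
      hamiltonianVectorField_eq (hf.isHamiltonianVectorAt hh hg k),
      hh.symplecticForm_kdvField hg]
  · obtain ⟨h, hh, -⟩ := exists_isLenardSequence 2 (-1)
    obtain ⟨k, rfl⟩ := Nat.exists_eq_add_of_le' hk
    rw [poissonBracket, hh.hamiltonianVectorField_kdvHamiltonian hg,
      hamiltonianVectorField_eq (hf.isHamiltonianVectorAt hh hg k),
      hh.symplecticForm_kdvField hg 1 k]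
  · obtain ⟨k, rfl⟩ := Nat.exists_eq_add_of_le' hk
    exact hf.functional_conserved k hu hsol s t
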